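/- Let $(\Omega,\mathcal F)$ be a measurable space and let $\mathfrak P$ be a nonempty set of probability measures on it. An event $N\in\mathcal F$ is called polar if $\mathbb P(N)=0$ for all $\mathbb P\in\mathfrak P$, and a property holds quasi-surely (q.s.) if it holds outside a polar event. Let $L^\infty_{\mathbf c}$ be the space of q.s. bounded real random variables modulo q.s. equality, with the q.s. order $\preceq$ and the norm $\|X\|=\inf\{m>0: |X|\le m\text{ q.s.}\}$. Let $ba$ be the space of finitely additive $\mu:\mathcal F\to\mathbb R$ with finite total variation norm $TV(\mu)=|\mu|(\Omega)$, where $|\mu|(A)=\sup\{\mu(B)-\mu(A\setminus B): B\in\mathcal F,\ B\subset A\}$, let $ba_{\mathbf c}$ be the subspace of those $\mu\in ba$ such that $|\mu|(N)=0$ for all polar $N$, and let $sca_{\mathbf c}$ be the subspace of those countably additive $\mu\in ba_{\mathbf c}$ that are supported, i.e. for which there is $S\in\mathcal F$ such that $|\mu|(\Omega\setminus S)=0$ and, for all $N\in\mathcal F$, $|\mu|(N\cap S)=0$ implies that $N\cap S$ is polar. For a subspace $\mathcal Y\subset ba_{\mathbf c}$, normed by $TV$, write $\mathcal Y^*=L^\infty_{\mathbf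 c}$ if $X\mapsto(\mu\mapsto\int X\,d\mu)$ is an isometric isomorphism from $L^\infty_{\mathbf c}$ onto the dual space of $(\mathcal Y,TV)$. A convex monetary risk measure is a convex function $\rho:L^\infty_{\mathbf c}\to\mathbb R$ such that $X\preceq Y$ implies $\rho(X)\le\rho(Y)$, and $\rho(X+m\mathbf 1_\Omega)=\rho(X)+m$ for all $X\in L^\infty_{\mathbf c}$ and $m\in\mathbb R$. A net $(X_\alpha)$ in $L^\infty_{\mathbf c}$ converges in order to $X$ if there is a decreasing net $(Y_\alpha)$ in $L^\infty_{\mathbf c}$ over the same index set with $\inf_\alpha Y_\alpha=0$ and $|X_\alpha-X|\preceq Y_\alpha$ for all $\alpha$. For a subspace $\mathcal Y\subset ba_{\mathbf c}$ and a convex monetary risk measure $\rho$ consider the following properties. - (F2) $\rho(X)\le\liminf_\alpha\rho(X_\alpha)$ for all nets $(X_\alpha)$ in $L^\infty_{\mathbf c}$ that converge in order to some $X\in L^\infty_{\mathbf c}$. - (F3) There is $\beta:\{\mathbb Q\in sca_{\mathbf c}:\mathbb Q\text{ a probability measure}\}\to\mathbb R\cup\{\infty\}$, bounded from below and not identically $\infty$,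 such that $\rho(X)=\sup_{\mathbb Q}\big(\mathbb E_{\mathbb Q}[X]-\beta(\mathbb Q)\big)$ for all $X\in L^\infty_{\mathbf c}$. - (F4) There is $\gamma:\mathcal Y\to\mathbb R\cup\{\infty\}$, bounded from below and not identically $\infty$, such that $\rho(X)=\sup_{\mu\in\mathcal Y}\big(\int X\,d\mu-\gamma(\mu)\big)$ for all $X\in L^\infty_{\mathbf c}$. **Theorem.** Suppose that $\mathcal Y$ is a subspace of $ba_{\mathbf c}$ with $\mathcal Y^*=L^\infty_{\mathbf c}$. 1. If (F2) and (F4) are equivalent for every convex monetary risk measure $\rho$ on $L^\infty_{\mathbf c}$, then $sca_{\mathbf c}^*=L^\infty_{\mathbf c}$. 2. If $sca_{\mathbf c}^*=L^\infty_{\mathbf c}$, then (F2) and (F3) are equivalent for every convex monetary risk measure $\rho$ on $L^\infty_{\mathbf c}$. -/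

import Mathlib

open MeasureTheory Set Filter Topology
open scoped ENNReal

namespace QuasiSure

noncomputable section

universe u

variable {Ω : Type u} [MeasurableSpace Ω]

/-! ## Upper probability, polar events, and the space of quasi-surely bounded random variables -/

/-- The upper probability `c(A) = sup_{P ∈ 𝔓} P(A)` induced by a set `𝔓` of probability measures. -/
def upperProb (𝔓 : Set (ProbabilityMeasure Ω)) (A : Set Ω) : ℝ≥0∞ :=
  ⨆ P ∈ 𝔓, (P : Measure Ω) A

/-- An event is `𝔓`-polar if its upper probability vanishes. -/
def IsPolar (𝔓 : Set (ProbabilityMeasure Ω)) (A : Set Ω) : Prop :=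
  MeasurableSet A ∧ upperProb 𝔓 A = 0

/-- The sum of all measures in `𝔓`. It serves only as a device to encode the quasi-sure order: its
null events are exactly the `𝔓`-polar events (see `ae_qsMeasure_iff`), so that "almost everywhere"
for this measure means "`𝔓`-quasi surely". -/
def qsMeasure (𝔓 : Set (ProbabilityMeasure Ω)) : Measure Ω :=
  Measure.sum fun P : 𝔓 => ((P : ProbabilityMeasure Ω) : Measure Ω)

theorem qsMeasure_eq_zero_iff (𝔓 : Set (ProbabilityMeasure Ω)) {A : Set Ω}
    (hA : MeasurableSet A) : qsMeasure 𝔓 A = 0 ↔ upperProb 𝔓 A = 0 := by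
  simp [qsMeasure, upperProb, Measure.sum_apply _ hA, ENNReal.tsum_eq_zero]

/-- A property holds almost everywhere for `qsMeasure 𝔓` iff it holds outside a `𝔓`-polar event. -/
theorem ae_qsMeasure_iff (𝔓 : Set (ProbabilityMeasure Ω)) (p : Ω → Prop) :
    (∀ᵐ ω ∂(qsMeasure 𝔓), p ω) ↔ ∃ N, IsPolar 𝔓 N ∧ ∀ ω, ω ∉ N → p ω := by
  constructor
  · intro h
    refine ⟨toMeasurable (qsMeasure 𝔓) {ω | ¬ p ω},
      ⟨measurableSet_toMeasurable _ _, ?_⟩, fun ω hω => ?_⟩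
    · rw [← qsMeasure_eq_zero_iff 𝔓 (measurableSet_toMeasurable _ _), measure_toMeasurable]
      exact h
    · by_contra hp
      exact hω (subset_toMeasurable _ _ hp)
  · rintro ⟨N, ⟨hN, hN0⟩, h⟩
    refine measure_mono_null (t := N) (fun ω hω => ?_) ((qsMeasure_eq_zero_iff 𝔓 hN).2 hN0)
    by_contra hn
    exact hω (h ω hn)

/-- The space `L^∞_c` of equivalence classes, up to `𝔓`-quasi-sure equality, of `𝔓`-quasi-surely
bounded random variables, with the `𝔓`-quasi-sure order and the quasi-sure supremum norm. -/
abbrev Linfty (𝔓 : Set (ProbabilityMeasure Ω)) : Type u := Lp ℝ ∞ (qsMeasure 𝔓)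

/-- The class `1_A` in `L^∞_c` of the indicator function of the event `A`. -/
def ind (𝔓 : Set (ProbabilityMeasure Ω)) (A : Set Ω) (hA : MeasurableSet A) : Linfty 𝔓 :=
  ((memLp_top_const (1 : ℝ)).indicator hA).toLp (A.indicator fun _ => (1 : ℝ))

/-- The class `1_Ω` in `L^∞_c` of the constant function `1`. -/
def one (𝔓 : Set (ProbabilityMeasure Ω)) : Linfty 𝔓 :=
  (memLp_top_const (1 : ℝ)).toLp (fun _ => (1 : ℝ))

theorem norm_le_iff (𝔓 : Set (ProbabilityMeasure Ω)) (X : Linfty 𝔓) {m : ℝ} (hm : 0 ≤ m) :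
    ‖X‖ ≤ m ↔ |X| ≤ m • one 𝔓 := by
  have h1 : (m • one 𝔓 : Linfty 𝔓) =ᵐ[qsMeasure 𝔓] fun _ => m := by
    filter_upwards [Lp.coeFn_smul m (one 𝔓),
      MemLp.coeFn_toLp (memLp_top_const (μ := qsMeasure 𝔓) (1 : ℝ))] with ω h h'
    rw [h, Pi.smul_apply, one, h']; simp
  rw [← Lp.coeFn_le]
  constructor
  · intro h
    have h2 : ∀ᵐ ω ∂(qsMeasure 𝔓), ‖X ω‖ ≤ ‖X‖ := by
      have := ae_le_eLpNormEssSup (f := X) (μ := qsMeasure 𝔓)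
      filter_upwards [this] with ω hω
      rw [Lp.norm_def, eLpNorm_exponent_top, ← toReal_enorm]
      refine ENNReal.toReal_mono ?_ hω
      have := Lp.eLpNorm_ne_top X
      rwa [eLpNorm_exponent_top] at this
    filter_upwards [h1, h2, Lp.coeFn_abs X] with ω a b c
    rw [c, a, ← Real.norm_eq_abs]; exact b.trans h
  · intro h
    rw [Lp.norm_def, eLpNorm_exponent_top]
    refine ENNReal.toReal_le_of_le_ofReal hm (eLpNormEssSup_le_of_ae_bound ?_)
    filter_upwards [h, h1, Lp.coeFn_abs X] with ω a b c
    rwa [b, c, ← Real.norm_eq_abs] at a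

/-! ## Bounded finitely additive set functions -/

/-- Finitely additive set functions on the events whose total variation norm is finite. They are
extended by the value `0` to sets that are not events. -/
def baSubmodule (Ω : Type u) [MeasurableSpace Ω] : Submodule ℝ (Set Ω → ℝ) where
  carrier := {μ | (∀ A, ¬ MeasurableSet A → μ A = 0) ∧
    (∀ A B, MeasurableSet A → MeasurableSet B → Disjoint A B → μ (A ∪ B) = μ A + μ B) ∧
    BddAbove {r : ℝ | ∃ B, MeasurableSet B ∧ r = μ B - μ Bᶜ}}
  zero_mem' := ⟨by simp, by simp, ⟨0, by rintro r ⟨B, -, rfl⟩; simp⟩⟩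
  add_mem' := by
    rintro μ ν ⟨h1, h2, ⟨c, hc⟩⟩ ⟨h1', h2', ⟨c', hc'⟩⟩
    refine ⟨fun A hA => by simp [h1 A hA, h1' A hA], fun A B hA hB hAB => ?_, ⟨c + c', ?_⟩⟩
    · simp only [Pi.add_apply, h2 A B hA hB hAB, h2' A B hA hB hAB]; ring
    · rintro r ⟨B, hB, rfl⟩
      have := hc ⟨B, hB, rfl⟩
      have := hc' ⟨B, hB, rfl⟩
      simp only [Pi.add_apply]; linarith
  smul_mem' := by
    rintro a μ ⟨h1, h2, ⟨c, hc⟩⟩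
    refine ⟨fun A hA => by simp [h1 A hA], fun A B hA hB hAB => ?_, ⟨|a| * c, ?_⟩⟩
    · simp only [Pi.smul_apply, smul_eq_mul, h2 A B hA hB hAB]; ring
    · rintro r ⟨B, hB, rfl⟩
      have h3 := hc ⟨B, hB, rfl⟩
      have h4 := hc ⟨Bᶜ, hB.compl, rfl⟩
      rw [compl_compl] at h4
      simp only [Pi.smul_apply, smul_eq_mul]
      rcases le_total 0 a with ha | ha
      · rw [abs_of_nonneg ha]; nlinarith
      · rw [abs_of_nonpos ha]; nlinarith

/-- The space `ba` of finitely additive set functions of bounded total variation. -/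
def BA (Ω : Type u) [MeasurableSpace Ω] : Type u := ↥(baSubmodule Ω)

namespace BA

instance : AddCommGroup (BA Ω) := inferInstanceAs (AddCommGroup ↥(baSubmodule Ω))

instance : Module ℝ (BA Ω) := inferInstanceAs (Module ℝ ↥(baSubmodule Ω))

instance : FunLike (BA Ω) (Set Ω) ℝ := ⟨fun μ => μ.1, Subtype.val_injective⟩

@[ext] theorem ext {μ ν : BA Ω} (h : ∀ A, MeasurableSet A → μ A = ν A) : μ = ν := by
  refine Subtype.ext (funext fun A => ?_)
  by_cases hA : MeasurableSet A
  · exact h A hA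
  · rw [μ.2.1 A hA, ν.2.1 A hA]

@[simp] theorem zero_apply (A : Set Ω) : (0 : BA Ω) A = 0 := rfl
@[simp] theorem add_apply (μ ν : BA Ω) (A : Set Ω) : (μ + ν) A = μ A + ν A := rfl
@[simp] theorem smul_apply (a : ℝ) (μ : BA Ω) (A : Set Ω) : (a • μ) A = a * μ A := rfl

theorem union (μ : BA Ω) {A B : Set Ω} (hA : MeasurableSet A) (hB : MeasurableSet B)
    (h : Disjoint A B) : μ (A ∪ B) = μ A + μ B := μ.2.2.1 A B hA hB h

@[simp] theorem empty (μ : BA Ω) : μ ∅ = 0 := by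
  have := μ.union MeasurableSet.empty MeasurableSet.empty (disjoint_bot_left (a := (∅ : Set Ω)))
  simp only [union_empty] at this
  linarith

/-- The modulus `|μ|(A) = sup {μ(B) - μ(A \ B) : B ∈ 𝓕, B ⊆ A}`. -/
def modulus (μ : BA Ω) (A : Set Ω) : ℝ :=
  sSup {r : ℝ | ∃ B, MeasurableSet B ∧ B ⊆ A ∧ r = μ B - μ (A \ B)}

/-- The total variation norm `TV(μ) = |μ|(Ω)`. -/
instance : Norm (BA Ω) := ⟨fun μ => μ.modulus univ⟩

theorem norm_def (μ : BA Ω) : ‖μ‖ = μ.modulus univ := rfl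

theorem le_norm (μ : BA Ω) {B : Set Ω} (hB : MeasurableSet B) : μ B - μ Bᶜ ≤ ‖μ‖ := by
  refine le_csSup ?_ ⟨B, hB, subset_univ _, by rw [compl_eq_univ_sdiff]⟩
  obtain ⟨c, hc⟩ := μ.2.2.2
  refine ⟨c, ?_⟩
  rintro r ⟨A, hA, -, rfl⟩
  rw [← compl_eq_univ_sdiff]
  exact hc ⟨A, hA, rfl⟩

theorem norm_le (μ : BA Ω) {c : ℝ} (h : ∀ B, MeasurableSet B → μ B - μ Bᶜ ≤ c) : ‖μ‖ ≤ c := by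
  refine csSup_le ⟨_, ∅, MeasurableSet.empty, empty_subset _, rfl⟩ ?_
  rintro r ⟨B, hB, -, rfl⟩
  rw [← compl_eq_univ_sdiff]
  exact h B hB

theorem apply_univ (μ : BA Ω) {A : Set Ω} (hA : MeasurableSet A) : μ univ = μ A + μ Aᶜ := by
  rw [← union_compl_self A, μ.union hA hA.compl disjoint_compl_right]

theorem norm_smul_le' (a : ℝ) (μ : BA Ω) : ‖a • μ‖ ≤ |a| * ‖μ‖ := by
  refine norm_le _ fun B hB => ?_
  have h3 := μ.le_norm hB
  have h4 := μ.le_norm hB.compl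
  rw [compl_compl] at h4
  simp only [smul_apply]
  rcases le_total 0 a with ha | ha
  · rw [abs_of_nonneg ha]; nlinarith
  · rw [abs_of_nonpos ha]; nlinarith

theorem norm_core : NormedSpace.Core ℝ (BA Ω) where
  norm_nonneg μ := by
    have h1 := μ.le_norm MeasurableSet.empty
    have h2 := μ.le_norm MeasurableSet.univ
    simp only [compl_empty, compl_univ] at h1 h2
    linarith
  norm_smul a μ := by
    refine le_antisymm (norm_smul_le' a μ) ?_
    rcases eq_or_ne a 0 with rfl | ha
    · have h1 := (0 • μ : BA Ω).le_norm MeasurableSet.empty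
      have h2 := (0 • μ : BA Ω).le_norm MeasurableSet.univ
      simp at h1 h2
      simpa using h1
    · have := norm_smul_le' a⁻¹ (a • μ)
      rw [smul_smul, inv_mul_cancel₀ ha, one_smul, abs_inv] at this
      have hpos : 0 < |a| := abs_pos.2 ha
      rw [Real.norm_eq_abs]
      calc |a| * ‖μ‖ ≤ |a| * (|a|⁻¹ * ‖a • μ‖) := by gcongr
        _ = ‖a • μ‖ := by field_simp
  norm_triangle μ ν := by
    refine norm_le _ fun B hB => ?_
    have h1 := μ.le_norm hB
    have h2 := ν.le_norm hB
    simp only [add_apply]; linarith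
  norm_eq_zero_iff μ := by
    constructor
    · intro h
      have key : ∀ A, MeasurableSet A → μ A = μ Aᶜ := fun A hA => by
        have h1 := μ.le_norm hA
        have h2 := μ.le_norm hA.compl
        rw [compl_compl] at h2
        linarith
      have h0 : μ univ = 0 := by simpa using key univ MeasurableSet.univ
      ext A hA
      have h1 := μ.apply_univ hA
      have h2 := key A hA
      simp only [zero_apply]; linarith
    · rintro rfl
      refine le_antisymm (norm_le _ fun B hB => by simp) ?_
      simpa using (0 : BA Ω).le_norm MeasurableSet.empty

instance : NormedAddCommGroup (BA Ω) := NormedAddCommGroup.ofCore norm_core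

instance : NormedSpace ℝ (BA Ω) := NormedSpace.ofCore norm_core

theorem modulus_eq_zero_iff {μ : BA Ω} {A : Set Ω} (hA : MeasurableSet A) :
    μ.modulus A = 0 ↔ ∀ B, MeasurableSet B → B ⊆ A → μ B = 0 := by
  have hbd : BddAbove {r : ℝ | ∃ B, MeasurableSet B ∧ B ⊆ A ∧ r = μ B - μ (A \ B)} := by
    refine ⟨‖μ‖ + |μ Aᶜ|, ?_⟩
    rintro r ⟨B, hB, hBA, rfl⟩
    have h1 := μ.le_norm hB
    have h2 : μ Bᶜ = μ (A \ B) + μ Aᶜ := by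
      rw [← μ.union (hA.diff hB) hA.compl
        (disjoint_compl_right.mono_left sdiff_subset)]
      refine congrArg (fun D : Set Ω => μ D) (Set.ext fun ω => ?_)
      simp only [mem_compl_iff, mem_union, Set.mem_sdiff]
      have := @hBA ω
      tauto
    have h3 := neg_abs_le (μ Aᶜ)
    linarith [le_abs_self (μ Aᶜ)]
  constructor
  · intro h
    have key : ∀ B, MeasurableSet B → B ⊆ A → μ B = μ (A \ B) := fun B hB hBA => by
      have h1 := le_csSup hbd ⟨B, hB, hBA, rfl⟩
      have h2 := le_csSup hbd ⟨A \ B, hA.diff hB, sdiff_subset, rfl⟩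
      rw [sdiff_sdiff_cancel_left hBA] at h2
      change _ ≤ μ.modulus A at h1
      change _ ≤ μ.modulus A at h2
      linarith
    have h0 : μ A = 0 := by simpa using key A hA subset_rfl
    intro B hB hBA
    have h1 := key B hB hBA
    have h2 := μ.union hB (hA.diff hB) disjoint_sdiff_right
    rw [union_sdiff_cancel hBA] at h2
    linarith
  · intro h
    have : {r : ℝ | ∃ B, MeasurableSet B ∧ B ⊆ A ∧ r = μ B - μ (A \ B)} = {0} := by
      ext r
      constructor
      · rintro ⟨B, hB, hBA, rfl⟩
        simp [h B hB hBA, h _ (hA.diff hB) sdiff_subset]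
      · rintro rfl
        exact ⟨∅, MeasurableSet.empty, empty_subset _, by simp [h A hA subset_rfl]⟩
    rw [modulus, this, csSup_singleton]

/-- Countable additivity. -/
def IsCountablyAdditive (μ : BA Ω) : Prop :=
  ∀ A : ℕ → Set Ω, (∀ i, MeasurableSet (A i)) → Pairwise (Function.onFun Disjoint A) →
    HasSum (fun i => μ (A i)) (μ (⋃ i, A i))

/-- `μ` is supported: there is an event `S` with `|μ|(Sᶜ) = 0` such that, for all events `N`,
`|μ|(N ∩ S) = 0` implies that `N ∩ S` is `𝔓`-polar. -/
def IsSupported (𝔓 : Set (ProbabilityMeasure Ω)) (μ : BA Ω) : Prop :=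
  ∃ S, MeasurableSet S ∧ μ.modulus Sᶜ = 0 ∧
    ∀ N, MeasurableSet N → μ.modulus (N ∩ S) = 0 → IsPolar 𝔓 (N ∩ S)

end BA

/-- `ba_c`: the `μ ∈ ba` dominated by `𝔓`, i.e. `|μ|` vanishes on all `𝔓`-polar events. -/
def baC (𝔓 : Set (ProbabilityMeasure Ω)) : Submodule ℝ (BA Ω) where
  carrier := {μ | ∀ N, IsPolar 𝔓 N → μ.modulus N = 0}
  zero_mem' := fun N hN => (BA.modulus_eq_zero_iff hN.1).2 (by simp)
  add_mem' := by
    intro μ ν hμ hν N hN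
    refine (BA.modulus_eq_zero_iff hN.1).2 fun B hB hBN => ?_
    rw [BA.add_apply, (BA.modulus_eq_zero_iff hN.1).1 (hμ N hN) B hB hBN,
      (BA.modulus_eq_zero_iff hN.1).1 (hν N hN) B hB hBN, add_zero]
  smul_mem' := by
    intro a μ hμ N hN
    refine (BA.modulus_eq_zero_iff hN.1).2 fun B hB hBN => ?_
    rw [BA.smul_apply, (BA.modulus_eq_zero_iff hN.1).1 (hμ N hN) B hB hBN, mul_zero]

namespace BA

/-- A countably additive element of `ba` as a Mathlib signed measure. -/
def toSigned (μ : BA Ω) (h : μ.IsCountablyAdditive) : SignedMeasure Ω where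
  measureOf' := μ
  empty' := μ.empty
  not_measurable' := fun A hA => μ.2.1 A hA
  m_iUnion' := fun A hA hd => h A hA hd

theorem variation_eq_zero_iff (μ : BA Ω) (h : μ.IsCountablyAdditive) {A : Set Ω}
    (hA : MeasurableSet A) : (μ.toSigned h).variation A = 0 ↔ μ.modulus A = 0 := by
  rw [VectorMeasure.variation_apply_eq_zero hA, modulus_eq_zero_iff hA]
  exact ⟨fun H B hB hBA => H B hBA hB, fun H B hBA hB => H B hB hBA⟩

theorem IsCountablyAdditive.add {μ ν : BA Ω} (hμ : μ.IsCountablyAdditive)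
    (hν : ν.IsCountablyAdditive) : (μ + ν).IsCountablyAdditive :=
  fun A hA hd => (hμ A hA hd).add (hν A hA hd)

theorem IsSupported.add {𝔓 : Set (ProbabilityMeasure Ω)} {μ ν : BA Ω}
    (hμ : μ.IsCountablyAdditive) (hν : ν.IsCountablyAdditive)
    (hμS : μ.IsSupported 𝔓) (hνS : ν.IsSupported 𝔓) : (μ + ν).IsSupported 𝔓 := by
  obtain ⟨S, hS, hS0, hSp⟩ := hμS
  obtain ⟨T, hT, hT0, hTp⟩ := hνS
  have hadd := hμ.add hν
  set m := (μ.toSigned hμ).variation with hm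
  set n := (ν.toSigned hν).variation with hn
  set k := ((μ + ν).toSigned hadd).variation with hk
  have fin : ∀ s : SignedMeasure Ω, IsFiniteMeasure s.variation := fun s => by
    rw [← SignedMeasure.totalVariation_eq_variation, SignedMeasure.totalVariation]
    infer_instance
  have : IsFiniteMeasure m := fin _
  have : IsFiniteMeasure n := fin _
  have : IsFiniteMeasure k := fin _
  have hle : k ≤ m + n := by
    have : (μ + ν).toSigned hadd = μ.toSigned hμ + ν.toSigned hν := by
      ext A hA; rfl
    rw [hk, this]
    exact VectorMeasure.variation_add_le
  have hac : k ≪ m + n := Measure.absolutelyContinuous_of_le hle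
  have hkd : (m + n).withDensity (k.rnDeriv (m + n)) = k := Measure.withDensity_rnDeriv_eq k (m + n) hac
  set f := k.rnDeriv (m + n) with hf
  have hfm : Measurable f := Measure.measurable_rnDeriv _ _
  have hpos : MeasurableSet {ω | f ω ≠ 0} := (hfm (measurableSet_singleton 0)).compl
  refine ⟨(S ∪ T) ∩ {ω | f ω ≠ 0}, (hS.union hT).inter hpos, ?_, fun N hN hN0 => ?_⟩
  · rw [← variation_eq_zero_iff _ hadd ((hS.union hT).inter hpos).compl, ← hk, compl_inter]
    refine measure_union_null (hac ?_) ?_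
    · rw [compl_union, Measure.add_apply, add_eq_zero]
      exact ⟨measure_mono_null inter_subset_left ((variation_eq_zero_iff _ hμ hS.compl).2 hS0),
        measure_mono_null inter_subset_right ((variation_eq_zero_iff _ hν hT.compl).2 hT0)⟩
    · rw [← hkd, withDensity_apply _ hpos.compl, lintegral_eq_zero_iff hfm, EventuallyEq,
        ae_restrict_iff' hpos.compl]
      exact Eventually.of_forall fun ω hω => by simpa using hω
  · have hmeas : MeasurableSet (N ∩ ((S ∪ T) ∩ {ω | f ω ≠ 0})) :=
      hN.inter ((hS.union hT).inter hpos)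
    have hz : (m + n) (N ∩ ((S ∪ T) ∩ {ω | f ω ≠ 0})) = 0 := by
      rw [← variation_eq_zero_iff _ hadd hmeas, ← hk, ← hkd, withDensity_apply _ hmeas,
        lintegral_eq_zero_iff hfm, EventuallyEq, ae_restrict_iff' hmeas] at hN0
      refine measure_mono_null (fun ω hω => ?_) hN0
      exact fun H => hω.2.2 (H hω)
    rw [Measure.add_apply, add_eq_zero] at hz
    set R := N ∩ ((S ∪ T) ∩ {ω | f ω ≠ 0}) with hR
    have hRS : IsPolar 𝔓 (R ∩ S) := hSp R hmeas
      ((variation_eq_zero_iff _ hμ (hmeas.inter hS)).1 (measure_mono_null inter_subset_left hz.1))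
    have hRT : IsPolar 𝔓 (R ∩ T) := hTp R hmeas
      ((variation_eq_zero_iff _ hν (hmeas.inter hT)).1 (measure_mono_null inter_subset_left hz.2))
    refine ⟨hmeas, (qsMeasure_eq_zero_iff 𝔓 hmeas).1 ?_⟩
    refine measure_mono_null (t := (R ∩ S) ∪ (R ∩ T)) (fun ω hω => ?_)
      (measure_union_null ((qsMeasure_eq_zero_iff 𝔓 hRS.1).2 hRS.2)
        ((qsMeasure_eq_zero_iff 𝔓 hRT.1).2 hRT.2))
    rcases hω.2.1 with h | h
    · exact Or.inl ⟨hω, h⟩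
    · exact Or.inr ⟨hω, h⟩

theorem zero_mem_aux (𝔓 : Set (ProbabilityMeasure Ω)) :
    (0 : BA Ω).IsCountablyAdditive ∧ (0 : BA Ω).IsSupported 𝔓 := by
  refine ⟨fun A _ _ => by simp, ∅, MeasurableSet.empty, ?_, fun N hN _ => ?_⟩
  · exact (modulus_eq_zero_iff MeasurableSet.empty.compl).2 fun B _ _ => rfl
  · exact ⟨hN.inter MeasurableSet.empty, by simp [upperProb]⟩

end BA

/-- `sca_c`: the supported countably additive `μ ∈ ba_c`, as a subspace of `ba_c`. -/
def scaC (𝔓 : Set (ProbabilityMeasure Ω)) : Submodule ℝ (baC 𝔓) where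
  carrier := {μ | BA.IsCountablyAdditive (μ : BA Ω) ∧ BA.IsSupported 𝔓 (μ : BA Ω)}
  zero_mem' := BA.zero_mem_aux 𝔓
  add_mem' := fun hμ hν => ⟨hμ.1.add hν.1, hμ.2.add hμ.1 hν.1 hν.2⟩
  smul_mem' := by
    rintro a μ ⟨h1, h2⟩
    rcases eq_or_ne a 0 with rfl | ha
    · rw [zero_smul]
      exact BA.zero_mem_aux 𝔓
    · obtain ⟨S, hS, hS0, hSp⟩ := h2
      have key : ∀ A, MeasurableSet A →
          ((a • (μ : BA Ω)).modulus A = 0 ↔ (μ : BA Ω).modulus A = 0) := fun A hA => by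
        rw [BA.modulus_eq_zero_iff hA, BA.modulus_eq_zero_iff hA]
        simp [ha]
      refine ⟨fun A hA hd => (h1 A hA hd).mul_left a, S, hS, (key _ hS.compl).2 hS0, ?_⟩
      exact fun N hN hN0 => hSp N hN ((key _ (hN.inter hS)).1 hN0)

/-! ## The integral of `X ∈ L^∞_c` with respect to `μ ∈ ba_c` -/

namespace BA

theorem apply_preimage_finset (μ : BA Ω) (s : SimpleFunc Ω ℝ) (F : Finset ℝ) :
    μ (s ⁻¹' (F : Set ℝ)) = ∑ x ∈ F, μ (s ⁻¹' {x}) := by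
  classical
  induction F using Finset.induction_on with
  | empty => simp
  | insert a F ha ih =>
    rw [Finset.sum_insert ha, ← ih, Finset.coe_insert, insert_eq, preimage_union,
      μ.union (s.measurableSet_preimage _) (s.measurableSet_preimage _)]
    exact Disjoint.preimage _ (by simpa using ha)

theorem sum_abs_le (μ : BA Ω) (s : SimpleFunc Ω ℝ) :
    ∑ x ∈ s.range, |μ (s ⁻¹' {x})| ≤ ‖μ‖ := by
  classical
  set p : ℝ → Prop := fun x => 0 ≤ μ (s ⁻¹' {x})
  have h1 := μ.le_norm (s.measurableSet_preimage ((s.range.filter p : Finset ℝ) : Set ℝ))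
  have h2 : (s ⁻¹' ((s.range.filter p : Finset ℝ) : Set ℝ))ᶜ
      = s ⁻¹' ((s.range.filter fun x => ¬ p x : Finset ℝ) : Set ℝ) := by
    ext ω; simp
  rw [h2, apply_preimage_finset, apply_preimage_finset] at h1
  rw [← Finset.sum_filter_add_sum_filter_not s.range p]
  rw [sub_eq_add_neg, ← Finset.sum_neg_distrib] at h1
  refine le_of_eq_of_le ?_ h1
  congr 1
  · exact Finset.sum_congr rfl fun x hx => abs_of_nonneg (Finset.mem_filter.1 hx).2
  · exact Finset.sum_congr rfl fun x hx =>
      abs_of_neg (not_le.1 (Finset.mem_filter.1 hx).2)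

theorem finMeasAdditive (μ : BA Ω) : FinMeasAdditive (0 : Measure Ω)
    (fun A => μ A • ContinuousLinearMap.id ℝ ℝ) := fun A B hA hB _ _ hd => by
  simp only [μ.union hA hB hd, add_smul]

/-- The integral `∑ x · μ(s = x)` of a simple function `s`. -/
def simpleIntegral (μ : BA Ω) : SimpleFunc Ω ℝ →ₗ[ℝ] ℝ where
  toFun s := s.setToSimpleFunc fun A => μ A • ContinuousLinearMap.id ℝ ℝ
  map_add' s t := SimpleFunc.setToSimpleFunc_add _ μ.finMeasAdditive
    (by simp [integrable_zero_measure]) (by simp [integrable_zero_measure])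
  map_smul' c s := SimpleFunc.setToSimpleFunc_smul _ μ.finMeasAdditive
    (fun c A x => by simp; ring) c (by simp [integrable_zero_measure])

theorem simpleIntegral_apply (μ : BA Ω) (s : SimpleFunc Ω ℝ) :
    μ.simpleIntegral s = ∑ x ∈ s.range, μ (s ⁻¹' {x}) * x := rfl

end BA

/-- The class in `L^∞_c` of a simple function. -/
def simpleClass (𝔓 : Set (ProbabilityMeasure Ω)) : SimpleFunc Ω ℝ →ₗ[ℝ] Linfty 𝔓 where
  toFun s := (s.memLp_top (qsMeasure 𝔓)).toLp s
  map_add' _ _ := rfl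
  map_smul' _ _ := rfl

theorem abs_simpleIntegral_le {𝔓 : Set (ProbabilityMeasure Ω)} (μ : baC 𝔓)
    (s : SimpleFunc Ω ℝ) : |(μ : BA Ω).simpleIntegral s| ≤ ‖(μ : BA Ω)‖ * ‖simpleClass 𝔓 s‖ := by
  set C := ‖simpleClass 𝔓 s‖ with hC
  have hae : ∀ᵐ ω ∂(qsMeasure 𝔓), |s ω| ≤ C := by
    have h1 := (norm_le_iff 𝔓 (simpleClass 𝔓 s) (norm_nonneg _)).1 le_rfl
    rw [← Lp.coeFn_le] at h1
    filter_upwards [h1, Lp.coeFn_abs (simpleClass 𝔓 s),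
      MemLp.coeFn_toLp (s.memLp_top (qsMeasure 𝔓)), Lp.coeFn_smul C (one 𝔓),
      MemLp.coeFn_toLp (memLp_top_const (μ := qsMeasure 𝔓) (1 : ℝ))] with ω a b c d e
    have c' : (simpleClass 𝔓 s) ω = s ω := c
    have e' : (one 𝔓) ω = 1 := e
    rw [b, d, Pi.smul_apply, c', e', smul_eq_mul, mul_one] at a
    exact a
  rw [BA.simpleIntegral_apply]
  calc |∑ x ∈ s.range, (μ : BA Ω) (s ⁻¹' {x}) * x|
      ≤ ∑ x ∈ s.range, |(μ : BA Ω) (s ⁻¹' {x})| * C := by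
        refine (Finset.abs_sum_le_sum_abs _ _).trans (Finset.sum_le_sum fun x _ => ?_)
        rw [abs_mul]
        by_cases hx : |x| ≤ C
        · gcongr
        · have hpol : IsPolar 𝔓 (s ⁻¹' {x}) := by
            refine ⟨s.measurableSet_fiber x,
              (qsMeasure_eq_zero_iff 𝔓 (s.measurableSet_fiber x)).1 ?_⟩
            refine measure_mono_null (fun ω hω => ?_) hae
            intro H
            rw [mem_preimage, mem_singleton_iff] at hω
            exact hx (hω ▸ H)
          rw [(BA.modulus_eq_zero_iff hpol.1).1 (μ.2 _ hpol) _ hpol.1 subset_rfl]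
          simp
    _ = (∑ x ∈ s.range, |(μ : BA Ω) (s ⁻¹' {x})|) * C := by rw [Finset.sum_mul]
    _ ≤ ‖(μ : BA Ω)‖ * C := by
        gcongr
        exact (μ : BA Ω).sum_abs_le s

theorem exists_simpleClass_near (𝔓 : Set (ProbabilityMeasure Ω)) (X : Linfty 𝔓) {ε : ℝ}
    (hε : 0 < ε) : ∃ s, ‖X - simpleClass 𝔓 s‖ ≤ ε := by
  have hX : Measurable X := (Lp.stronglyMeasurable X).measurable
  set M := ‖X‖
  set g : Ω → ℝ := fun ω => max (-M) (min M (X ω)) with hg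
  have hgm : Measurable g := measurable_const.max (measurable_const.min hX)
  have hfl : Measurable fun ω => ⌊g ω / ε⌋ := (hgm.div_const ε).floor
  let s : SimpleFunc Ω ℝ :=
    { toFun := fun ω => ε * (⌊g ω / ε⌋ : ℝ)
      measurableSet_fiber' := fun x =>
        (measurable_const.mul (measurable_from_top.comp hfl) :
          Measurable fun ω => ε * ((⌊g ω / ε⌋ : ℤ) : ℝ)) (measurableSet_singleton x)
      finite_range' := by
        refine ((Set.finite_Icc ⌊-M / ε⌋ ⌊M / ε⌋).image fun k : ℤ => ε * (k : ℝ)).subset ?_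
        rintro _ ⟨ω, rfl⟩
        have hM : 0 ≤ M := norm_nonneg _
        refine ⟨⌊g ω / ε⌋, ⟨Int.floor_le_floor ?_, Int.floor_le_floor ?_⟩, rfl⟩
        · exact div_le_div_of_nonneg_right (le_max_left _ _) hε.le
        · exact div_le_div_of_nonneg_right
            (max_le (by linarith) (min_le_left _ _)) hε.le }
  refine ⟨s, (norm_le_iff 𝔓 _ hε.le).2 ?_⟩
  rw [← Lp.coeFn_le]
  have h1 := (norm_le_iff 𝔓 X (norm_nonneg _)).1 le_rfl
  rw [← Lp.coeFn_le] at h1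
  filter_upwards [h1, Lp.coeFn_abs X, Lp.coeFn_smul M (one 𝔓), Lp.coeFn_smul ε (one 𝔓),
    Lp.coeFn_abs (X - simpleClass 𝔓 s), Lp.coeFn_sub X (simpleClass 𝔓 s),
    MemLp.coeFn_toLp (s.memLp_top (qsMeasure 𝔓)),
    MemLp.coeFn_toLp (memLp_top_const (μ := qsMeasure 𝔓) (1 : ℝ))] with ω a b c d e f h i
  have h' : (simpleClass 𝔓 s) ω = ε * (⌊g ω / ε⌋ : ℝ) := h
  have i' : (one 𝔓) ω = 1 := i
  rw [b, c, Pi.smul_apply, i', smul_eq_mul, mul_one] at a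
  have hgX : g ω = X ω := by
    rw [abs_le] at a
    rw [hg]; simp only
    rw [min_eq_right a.2, max_eq_right a.1]
  rw [e, f, d, Pi.smul_apply, Pi.sub_apply, i', h', hgX, smul_eq_mul, mul_one, abs_le]
  have j1 := Int.floor_le (X ω / ε)
  have j2 := Int.lt_floor_add_one (X ω / ε)
  rw [le_div_iff₀ hε] at j1
  rw [div_lt_iff₀ hε] at j2
  constructor <;> nlinarith

theorem simpleClass_indicator (𝔓 : Set (ProbabilityMeasure Ω)) {A : Set Ω}
    (hA : MeasurableSet A) :
    simpleClass 𝔓 (SimpleFunc.piecewise A hA (SimpleFunc.const Ω 1) (SimpleFunc.const Ω 0))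
      = ind 𝔓 A hA := by
  refine MemLp.toLp_congr (SimpleFunc.memLp_top _ _) _ (Eventually.of_forall fun ω => ?_)
  by_cases h : ω ∈ A <;> simp [h]

/-- For `μ ∈ ba_c` there is exactly one continuous linear functional on `L^∞_c` that takes the
value `μ(A)` at `1_A` for every event `A`. -/
theorem existsUnique_integral {𝔓 : Set (ProbabilityMeasure Ω)} (μ : baC 𝔓) :
    ∃! φ : Linfty 𝔓 →L[ℝ] ℝ, ∀ A hA, φ (ind 𝔓 A hA) = (μ : BA Ω) A := by
  have hker : LinearMap.ker (simpleClass 𝔓) ≤ LinearMap.ker (μ : BA Ω).simpleIntegral := by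
    intro s hs
    rw [LinearMap.mem_ker] at hs ⊢
    have := abs_simpleIntegral_le μ s
    rw [hs, norm_zero, mul_zero] at this
    exact abs_eq_zero.1 (le_antisymm this (abs_nonneg _))
  let ψ : LinearMap.range (simpleClass 𝔓) →ₗ[ℝ] ℝ :=
    ((LinearMap.ker (simpleClass 𝔓)).liftQ _ hker).comp
      (simpleClass 𝔓).quotKerEquivRange.symm.toLinearMap
  have hψ : ∀ s, ψ ⟨simpleClass 𝔓 s, s, rfl⟩ = (μ : BA Ω).simpleIntegral s := by
    intro s
    have : (simpleClass 𝔓).quotKerEquivRange.symm ⟨simpleClass 𝔓 s, s, rfl⟩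
        = Submodule.Quotient.mk s := by
      rw [LinearEquiv.symm_apply_eq]; rfl
    simp only [ψ, LinearMap.comp_apply, LinearEquiv.coe_coe, this]
    rfl
  let ψ' : LinearMap.range (simpleClass 𝔓) →L[ℝ] ℝ := ψ.mkContinuous ‖(μ : BA Ω)‖ (by
    rintro ⟨_, s, rfl⟩
    rw [hψ]
    exact abs_simpleIntegral_le μ s)
  obtain ⟨φ, hφ, -⟩ := exists_extension_norm_eq _ ψ'
  refine ⟨φ, fun A hA => ?_, fun φ' hφ' => ?_⟩
  · rw [← simpleClass_indicator 𝔓 hA]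
    refine (hφ ⟨_, _, rfl⟩).trans ((hψ _).trans ?_)
    have := SimpleFunc.setToSimpleFunc_indicator
      (fun A => (μ : BA Ω) A • ContinuousLinearMap.id ℝ ℝ) (by simp) hA (1 : ℝ)
    exact this.trans (by simp)
  · have hφA : ∀ A hA, φ (ind 𝔓 A hA) = (μ : BA Ω) A := by
      intro A hA
      rw [← simpleClass_indicator 𝔓 hA]
      refine (hφ ⟨_, _, rfl⟩).trans ((hψ _).trans ?_)
      have := SimpleFunc.setToSimpleFunc_indicator
        (fun A => (μ : BA Ω) A • ContinuousLinearMap.id ℝ ℝ) (by simp) hA (1 : ℝ)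
      exact this.trans (by simp)
    have hs : ∀ s, φ' (simpleClass 𝔓 s) = φ (simpleClass 𝔓 s) := by
      intro s
      induction s using SimpleFunc.induction with
      | const c hA =>
        rename_i A
        have : SimpleFunc.piecewise A hA (SimpleFunc.const Ω c) (SimpleFunc.const Ω 0)
            = c • SimpleFunc.piecewise A hA (SimpleFunc.const Ω 1) (SimpleFunc.const Ω 0) := by
          ext ω
          by_cases h : ω ∈ A <;> simp [h]
        rw [this, map_smul, map_smul, map_smul, simpleClass_indicator, hφ', hφA]
      | add hd h1 h2 => rw [map_add, map_add, map_add, h1, h2]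
    have hd : DenseRange (simpleClass 𝔓) := by
      refine Metric.dense_iff.2 fun X r hr => ?_
      obtain ⟨s, hs⟩ := exists_simpleClass_near 𝔓 X (half_pos hr)
      refine ⟨simpleClass 𝔓 s, ?_, s, rfl⟩
      rw [Metric.mem_ball, dist_comm, dist_eq_norm]
      linarith
    refine ContinuousLinearMap.ext fun X => ?_
    exact congrFun (hd.equalizer φ'.continuous φ.continuous (funext hs)) X

/-- The integral `X ↦ ∫ X dμ` of elements of `L^∞_c` with respect to the finitely additive
`μ ∈ ba_c`: the unique continuous linear functional on `L^∞_c` with `∫ 1_A dμ = μ(A)` for all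
events `A`; equivalently, the limit of the elementary integrals of simple functions that converge
to `X` in the norm of `L^∞_c`. -/
def integral {𝔓 : Set (ProbabilityMeasure Ω)} (μ : baC 𝔓) : Linfty 𝔓 →L[ℝ] ℝ :=
  (existsUnique_integral μ).choose

theorem integral_ind {𝔓 : Set (ProbabilityMeasure Ω)} (μ : baC 𝔓) (A : Set Ω)
    (hA : MeasurableSet A) : integral μ (ind 𝔓 A hA) = (μ : BA Ω) A :=
  (existsUnique_integral μ).choose_spec.1 A hA

/-- `Y^* = L^∞_c`: for a subspace `Y` of `(ba_c, TV)`, the map that sends `X ∈ L^∞_c` to the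
functional `μ ↦ ∫ X dμ` is an isometric isomorphism of `L^∞_c` onto the dual space of `Y`. -/
def DualIsLinfty {𝔓 : Set (ProbabilityMeasure Ω)} (Y : Submodule ℝ (baC 𝔓)) : Prop :=
  ∃ e : Linfty 𝔓 ≃ₗᵢ[ℝ] StrongDual ℝ Y, ∀ (X : Linfty 𝔓) (μ : Y), e X μ = integral (μ : baC 𝔓) X

/-! ## Convex monetary risk measures -/

/-- Convex monetary risk measures on `L^∞_c`: convex, monotone and cash-additive functions. -/
structure IsConvexRiskMeasure {𝔓 : Set (ProbabilityMeasure Ω)} (ρ : Linfty 𝔓 → ℝ) : Prop where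
  convex : ConvexOn ℝ univ ρ
  mono : ∀ X Y : Linfty 𝔓, X ≤ Y → ρ X ≤ ρ Y
  cash_additive : ∀ (X : Linfty 𝔓) (m : ℝ), ρ (X + m • one 𝔓) = ρ X + m

/-- Order convergence of a net in a vector lattice: `|x_α - x| ≤ y_α` for all `α`, where the net
`(y_α)` is decreasing with infimum `0`. -/
def OrderConverges {E : Type*} [Lattice E] [AddCommGroup E] {I : Type*} [Preorder I]
    (x : I → E) (x₀ : E) : Prop :=
  ∃ y : I → E, Antitone y ∧ IsGLB (range y) 0 ∧ ∀ α, |x α - x₀| ≤ y α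

/-- The Fatou property: `ρ(X) ≤ liminf ρ(X_α)` for all nets `(X_α)` that converge to `X` in
order. -/
def FatouProperty {𝔓 : Set (ProbabilityMeasure Ω)} (ρ : Linfty 𝔓 → ℝ) : Prop :=
  ∀ (I : Type u) [Preorder I] [IsDirectedOrder I] [Nonempty I] (X : I → Linfty 𝔓)
    (X₀ : Linfty 𝔓), OrderConverges X X₀ →
      (ρ X₀ : EReal) ≤ liminf (fun α => (ρ (X α) : EReal)) atTop

/-- `ρ(X) = sup_{i ∈ D} (ℓ_i(X) - γ(i))` for some penalty `γ : D → ℝ ∪ {∞}` that is bounded from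
below and not identically `∞`. -/
def HasRepresentation {𝔓 : Set (ProbabilityMeasure Ω)} (ρ : Linfty 𝔓 → ℝ) {D : Type*}
    (ℓ : D → Linfty 𝔓 → ℝ) : Prop :=
  ∃ γ : D → EReal, (∃ b : ℝ, ∀ i, (b : EReal) ≤ γ i) ∧ (∃ i, γ i ≠ ⊤) ∧
    ∀ X : Linfty 𝔓, (ρ X : EReal) = ⨆ i, ((ℓ i X : ℝ) : EReal) - γ i

/-- A representation `ρ(X) = sup_{μ ∈ Y} (∫ X dμ - γ(μ))` over a subspace `Y` of `ba_c`. -/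
def HasDualRepresentation {𝔓 : Set (ProbabilityMeasure Ω)} (Y : Submodule ℝ (baC 𝔓))
    (ρ : Linfty 𝔓 → ℝ) : Prop :=
  HasRepresentation ρ fun (μ : Y) X => integral (μ : baC 𝔓) X

/-- `sca_c ∩ Δ(𝓕)`: the probability measures that are, as set functions, elements of `sca_c`. -/
def SupportedProb (𝔓 : Set (ProbabilityMeasure Ω)) : Set (ProbabilityMeasure Ω) :=
  {Q | ∃ μ ∈ scaC 𝔓, ∀ A, MeasurableSet A → (μ : BA Ω) A = (Q : Measure Ω).real A}

/-- A representation `ρ(X) = sup_Q (𝔼_Q[X] - β(Q))` over the supported probability measures. -/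
def HasSupportedRepresentation {𝔓 : Set (ProbabilityMeasure Ω)} (ρ : Linfty 𝔓 → ℝ) : Prop :=
  HasRepresentation ρ fun (Q : SupportedProb 𝔓) X =>
    ∫ ω, X ω ∂((Q : ProbabilityMeasure Ω) : Measure Ω)

end

end QuasiSure

/-! The link between the two sides is order continuity. Suppose a subspace of `ba_c` has dual
`L^∞_c`. Bounded sets are then relatively weak-star compact, and each order interval `[0, M]` is a
norm ball around `M/2`, hence weak-star closed. A decreasing net that is bounded below therefore
converges weak-star to its infimum (`exists_isGLB_tendsto`). So such infima exist, and every element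
of the predual is order continuous. Order continuous functionals are countably additive and, because
infima exist, supported (`OrderContinuous.mem_scaC`). Conversely, expectations under supported
probabilities are order continuous (`orderContinuous_expectation`), and these probabilities span
`sca_c` (`scaC_le_of_supportedProb`).

For the first assertion, `Y ≤ sca_c` by the above. For a supported probability `Q`, the expectation
is a risk measure with the Fatou property, so it is represented over `Y`. Some `∫ · dμ` with `μ ∈ Y`
is then below it up to a constant; by linearity the two agree and `Q ∈ Y`. Hence `Y = sca_c`.

For the second, a supremum of order continuous affine functions is Fatou. For the converse, bounded
parts of sublevel sets are shown to be weak-star closed (`FatouProperty.le_of_mem_closure`): weak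
closure of a convex set is improved to `L¹(m)`-closure, Borel–Cantelli gives convergence q.s. on a
set dominated by `m`, and the Fatou property is used once on that set and once to exhaust `Ω` by
such sets. A Krein–Smulian separation follows. As the predual need not be complete, its separating
functional is found only in the bidual; it is weak-star continuous on bounded sets, hence order
continuous, and so belongs to `sca_c` after all. Monotonicity and cash-additivity turn it into a
supported probability. -/

/-! ### Krein–Smulian separation without completeness -/

/-- Separation step of the Krein–Smulian theorem: if the convex set `K` in the dual of `E` has
weak-star closed intersections with all balls and stays away from the origin, then it can be
separated from the origin by a functional that is weak-star continuous on bounded sets. -/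
theorem exists_separating_of_isClosed_inter_closedBall {E : Type*} [NormedAddCommGroup E]
    [NormedSpace ℝ E] {K : Set (StrongDual ℝ E)} (hK : Convex ℝ K)
    (hc : ∀ r : ℝ, IsClosed {f : WeakDual ℝ E |
      WeakDual.toStrongDual f ∈ K ∧ ‖WeakDual.toStrongDual f‖ ≤ r})
    {δ : ℝ} (hδ : 0 < δ) (hd : ∀ f ∈ K, δ < ‖f‖) :
    ∃ φ : StrongDual ℝ (StrongDual ℝ E), (∀ f ∈ K, 1 ≤ φ f) ∧
      ∀ ε > 0, ∀ R : ℝ, ∃ F : Finset E, ∀ f : StrongDual ℝ E, ‖f‖ ≤ R →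
        (∀ x ∈ F, |f x| ≤ ε) → φ f ≤ ε := by
  classical
  set r : ℕ → ℝ := fun n => δ * (n + 1) with hr
  have hrpos : ∀ n, 0 < r n := fun n => by positivity
  have hrmono : Monotone r := fun a b h => by
    simp only [hr]; gcongr
  -- The part of `K` in the ball of radius `r n` misses the polar of `P`.
  let Good : ℕ → Finset E → Prop := fun n P =>
    ∀ f ∈ K, ‖f‖ ≤ r n → ∃ x ∈ P, 1 < |f x|
  have step : ∀ n P, Good n P → ∃ P', Good (n + 1) P' ∧ P ⊆ P' ∧
      ∀ x ∈ P', x ∈ P ∨ ‖x‖ ≤ (r n)⁻¹ := by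
    intro n P hP
    have hcomp : IsCompact {f : WeakDual ℝ E |
        WeakDual.toStrongDual f ∈ K ∧ ‖WeakDual.toStrongDual f‖ ≤ r (n + 1)} := by
      refine (WeakDual.isCompact_closedBall (0 : StrongDual ℝ E) (r (n + 1))).of_isClosed_subset
        (hc _) fun f hf => ?_
      simpa using hf.2
    let U : {x : E // x ∈ P ∨ ‖x‖ ≤ (r n)⁻¹} → Set (WeakDual ℝ E) := fun x => {f | 1 < |f x.1|}
    -- A functional missed by every `U x` is at most 1 on the ball of radius `(r n)⁻¹`, so its norm
    -- is at most `r n`, and then `P` already catches it. Compactness leaves finitely many new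
    -- points.
    obtain ⟨t, ht⟩ := hcomp.elim_finite_subcover U
      (fun x => isOpen_lt continuous_const (WeakDual.eval_continuous x.1).abs) (by
        intro f hf
        by_contra hcon
        have hle : ∀ x : E, (x ∈ P ∨ ‖x‖ ≤ (r n)⁻¹) → |f x| ≤ 1 := fun x hx => by
          by_contra h
          exact hcon (mem_iUnion.2 ⟨⟨x, hx⟩, not_le.1 h⟩)
        have hn : ‖WeakDual.toStrongDual f‖ ≤ r n := by
          refine ContinuousLinearMap.opNorm_le_of_unit_norm (hrpos n).le fun x hx => ?_
          have := hle ((r n)⁻¹ • x) (Or.inr (by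
            rw [norm_smul, hx, mul_one, norm_inv, Real.norm_of_nonneg (hrpos n).le]))
          rw [map_smul, smul_eq_mul, abs_mul, abs_inv, abs_of_pos (hrpos n),
            inv_mul_le_iff₀ (hrpos n), mul_one] at this
          exact this
        obtain ⟨x, hx, hx1⟩ := hP _ hf.1 hn
        exact absurd (hle x (Or.inl hx)) (not_le.2 hx1))
    refine ⟨P ∪ t.image Subtype.val, ?_, Finset.subset_union_left, ?_⟩
    · intro f hf hfr
      obtain ⟨x, hx, hfx⟩ := mem_iUnion₂.1 (ht (show StrongDual.toWeakDual f ∈ _ from ⟨hf, hfr⟩))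
      exact ⟨x.1, Finset.mem_union_right _ (Finset.mem_image_of_mem _ hx), hfx⟩
    · intro x hx
      rcases Finset.mem_union.1 hx with h | h
      · exact Or.inl h
      · obtain ⟨y, -, rfl⟩ := Finset.mem_image.1 h
        exact y.2
  -- `r 0 = δ`, and `K` has no element of norm at most `δ`.
  have h0 : Good 0 ∅ := fun f hf hfr => by
    have := hd f hf
    simp [hr] at hfr
    linarith
  choose! g hg1 hg2 hg3 using step
  let P : ℕ → Finset E := fun n => Nat.rec ∅ (fun n P => g n P) n
  have hP : ∀ n, Good n (P n) := fun n => by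
    induction n with
    | zero => exact h0
    | succ n ih => exact hg1 n _ ih
  have hPs : ∀ n, P n ⊆ P (n + 1) := fun n => hg2 n _ (hP n)
  have hPn : ∀ n, ∀ x ∈ P (n + 1), x ∈ P n ∨ ‖x‖ ≤ (r n)⁻¹ := fun n => hg3 n _ (hP n)
  have hPtail : ∀ n m, ∀ x ∈ P m, x ∈ P n ∨ ‖x‖ ≤ (r n)⁻¹ := by
    intro n m
    induction m with
    | zero => intro x hx; simp [P] at hx
    | succ m ih =>
      intro x hx
      rcases le_or_gt n m with h | h
      · rcases hPn m x hx with h' | h'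
        · exact ih x h'
        · exact Or.inr (h'.trans (inv_anti₀ (hrpos n) (hrmono h)))
      · exact Or.inl (monotone_nat_of_le_succ hPs h hx)
  -- The common polar of all `P n`. It misses `K`, and it contains the `δ`-ball because every chosen
  -- point has norm at most `δ⁻¹`.
  let W : Set (StrongDual ℝ E) := {f | ∀ n, ∀ x ∈ P n, |f x| ≤ 1}
  have hWconv : Convex ℝ W := by
    intro f hf f' hf' a b ha hb hab n x hx
    have h1 := abs_le.1 (hf n x hx)
    have h2 := abs_le.1 (hf' n x hx)
    simp only [add_apply, smul_apply, smul_eq_mul]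
    rw [abs_le]
    constructor <;> nlinarith
  have hball : Metric.ball (0 : StrongDual ℝ E) δ ⊆ W := by
    intro f hf n x hx
    rw [mem_ball_zero_iff] at hf
    rcases hPtail 0 n x hx with h | h
    · simp [P] at h
    · have h3 : (r 0)⁻¹ = δ⁻¹ := by simp [hr]
      rw [h3] at h
      calc |f x| ≤ ‖f‖ * ‖x‖ := f.le_opNorm x
        _ ≤ δ * δ⁻¹ := by gcongr
        _ = 1 := mul_inv_cancel₀ hδ.ne'
  have hWnhds : W ∈ 𝓝 (0 : StrongDual ℝ E) := mem_of_superset (Metric.ball_mem_nhds _ hδ) hball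
  have hdisj : Disjoint (interior W) K := by
    rw [Set.disjoint_left]
    intro f hfW hfK
    obtain ⟨n, hn⟩ := exists_nat_ge (‖f‖ / δ)
    have hn' : ‖f‖ ≤ r n := by
      rw [div_le_iff₀ hδ] at hn
      simp only [hr]; nlinarith
    obtain ⟨x, hx, hx1⟩ := hP n f hfK hn'
    exact absurd (interior_subset hfW n x hx) (not_le.2 hx1)
  obtain ⟨φ, u, hφW, hφK⟩ := geometric_hahn_banach_open hWconv.interior isOpen_interior hK hdisj
  have hu : 0 < u := by simpa using hφW 0 (mem_interior_iff_mem_nhds.2 hWnhds)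
  have hφW' : ∀ f ∈ W, φ f ≤ u := by
    intro f hf
    have h1 : f ∈ closure (interior W) := by
      rw [hWconv.closure_interior_eq_closure_of_nonempty_interior
        ⟨0, mem_interior_iff_mem_nhds.2 hWnhds⟩]
      exact subset_closure hf
    exact closure_minimal (fun f hf => (hφW f hf).le)
      (isClosed_le φ.continuous continuous_const) h1
  refine ⟨u⁻¹ • φ, fun f hf => ?_, fun ε hε R => ?_⟩
  · rw [smul_apply, smul_eq_mul, ← div_eq_inv_mul, le_div_iff₀ hu, one_mul]
    exact hφK f hf
  -- With `R ≤ ε * r n`, points outside `P n` have norm at most `(r n)⁻¹` and satisfy `|f x| ≤ ε`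
  -- automatically. So finitely many conditions put `ε⁻¹ • f` into `W`.
  · obtain ⟨n, hn⟩ := exists_nat_ge (R / (ε * δ))
    refine ⟨P n, fun f hfR hf => ?_⟩
    have hεδ : 0 < ε * δ := by positivity
    have hRn : R ≤ ε * r n := by
      rw [div_le_iff₀ hεδ] at hn
      simp only [hr]; nlinarith
    have hfW : ε⁻¹ • f ∈ W := by
      intro m x hx
      rw [smul_apply, smul_eq_mul, abs_mul, abs_inv, abs_of_pos hε,
        inv_mul_le_iff₀ hε, mul_one]
      rcases hPtail n m x hx with h | h
      · exact hf x h
      · calc |f x| ≤ ‖f‖ * ‖x‖ := f.le_opNorm x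
          _ ≤ (ε * r n) * (r n)⁻¹ := by
            gcongr
            exact hfR.trans hRn
          _ = ε := by rw [mul_assoc, mul_inv_cancel₀ (hrpos n).ne', mul_one]
    have := hφW' _ hfW
    rw [map_smul, smul_eq_mul, inv_mul_le_iff₀ hε] at this
    rw [smul_apply, smul_eq_mul, inv_mul_le_iff₀ hu]
    linarith

namespace QuasiSure

universe u

variable {Ω : Type u} [MeasurableSpace Ω] {𝔓 : Set (ProbabilityMeasure Ω)}

/-! ### Order and norm in `L^∞_c` -/

theorem coeFn_one (𝔓 : Set (ProbabilityMeasure Ω)) : one 𝔓 =ᵐ[qsMeasure 𝔓] fun _ => (1 : ℝ) :=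
  MemLp.coeFn_toLp _

theorem coeFn_ind (𝔓 : Set (ProbabilityMeasure Ω)) {A : Set Ω} (hA : MeasurableSet A) :
    ind 𝔓 A hA =ᵐ[qsMeasure 𝔓] A.indicator fun _ => (1 : ℝ) :=
  MemLp.coeFn_toLp _

theorem coeFn_smul_one (𝔓 : Set (ProbabilityMeasure Ω)) (m : ℝ) :
    (m • one 𝔓 : Linfty 𝔓) =ᵐ[qsMeasure 𝔓] fun _ => m := by
  filter_upwards [Lp.coeFn_smul m (one 𝔓), coeFn_one 𝔓] with ω h h'
  rw [h, Pi.smul_apply, h']; simp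

theorem one_nonneg (𝔓 : Set (ProbabilityMeasure Ω)) : 0 ≤ one 𝔓 := by
  rw [← Lp.coeFn_nonneg]
  filter_upwards [coeFn_one 𝔓] with ω h
  rw [h]; exact zero_le_one

theorem smul_nonneg' {m : ℝ} (hm : 0 ≤ m) {X : Linfty 𝔓} (hX : 0 ≤ X) : 0 ≤ m • X := by
  rw [← Lp.coeFn_nonneg] at hX ⊢
  filter_upwards [hX, Lp.coeFn_smul m X] with ω h h'
  rw [h']; exact mul_nonneg hm h

theorem le_norm_smul_one (X : Linfty 𝔓) : X ≤ ‖X‖ • one 𝔓 :=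
  (le_abs_self X).trans ((norm_le_iff 𝔓 X (norm_nonneg X)).1 le_rfl)

theorem norm_le_of_abs_le {X Y : Linfty 𝔓} (h : |X| ≤ Y) : ‖X‖ ≤ ‖Y‖ :=
  (norm_le_iff 𝔓 X (norm_nonneg Y)).2 (h.trans (le_norm_smul_one Y))

/-- Turns order intervals into balls, so that weak-star closedness of balls yields weak-star
closedness of order relations. -/
theorem norm_sub_half_le_iff {X : Linfty 𝔓} {M : ℝ} (hM : 0 ≤ M) :
    ‖X - (M / 2) • one 𝔓‖ ≤ M / 2 ↔ 0 ≤ X ∧ X ≤ M • one 𝔓 := by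
  have h2 : M • one 𝔓 = (M / 2) • one 𝔓 + (M / 2) • one 𝔓 := by rw [← add_smul, add_halves]
  rw [norm_le_iff 𝔓 _ (by linarith), abs_le', h2, sub_le_iff_le_add, neg_sub, and_comm,
    sub_le_self_iff]

/-! ### Predual, weak-star limits and order continuity -/

/-- A linear functional is order continuous if it maps decreasing nets with infimum `0` to null
nets. -/
def OrderContinuous (φ : Linfty 𝔓 → ℝ) : Prop :=
  ∀ (I : Type u) [Preorder I] [IsDirectedOrder I] [Nonempty I] (X : I → Linfty 𝔓),
    Antitone X → IsGLB (range X) 0 → Tendsto (fun α => φ (X α)) atTop (𝓝 0)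

/-- Replaces the nested submodule by an abstract normed space `E`, for which the weak-star arguments
are stated. -/
theorem DualIsLinfty.exists_predual {Y : Submodule ℝ (baC 𝔓)} (hY : DualIsLinfty Y) :
    ∃ (E : Type u) (_ : NormedAddCommGroup E) (_ : NormedSpace ℝ E)
      (e : Linfty 𝔓 ≃ₗᵢ[ℝ] StrongDual ℝ E) (j : E → baC 𝔓), range j = Y ∧
      ∀ X ν, e X ν = integral (j ν) X := by
  obtain ⟨e, he⟩ := hY
  exact ⟨Y, Submodule.normedAddCommGroup Y, Submodule.normedSpace Y, e, Subtype.val,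
    Subtype.range_coe, he⟩

section Predual

variable {E : Type*} [NormedAddCommGroup E] [NormedSpace ℝ E] (e : Linfty 𝔓 ≃ₗᵢ[ℝ] StrongDual ℝ E)

/-- Weak-star lower semicontinuity of the norm. -/
theorem norm_sub_le_of_tendsto {I : Type*} {l : Filter I} [l.NeBot]
    {X : I → Linfty 𝔓} {Z : Linfty 𝔓} {r : ℝ} (hr : 0 ≤ r)
    (h : ∀ ν, Tendsto (fun α => e (X α) ν) l (𝓝 (e Z ν)))
    (C : Linfty 𝔓) (hC : ∀ᶠ α in l, ‖X α - C‖ ≤ r) : ‖Z - C‖ ≤ r := by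
  rw [← e.norm_map]
  refine ContinuousLinearMap.opNorm_le_bound _ hr fun ν => ?_
  rw [map_sub, sub_apply]
  refine le_of_tendsto ((h ν).sub_const _).norm ?_
  filter_upwards [hC] with α hα
  rw [← sub_apply, ← map_sub]
  refine ((e (X α - C)).le_opNorm ν).trans ?_
  rw [e.norm_map]
  gcongr

theorem nonneg_of_tendsto_predual {I : Type*} {l : Filter I} [l.NeBot]
    {X : I → Linfty 𝔓} {Z : Linfty 𝔓} {M : ℝ}
    (h : ∀ ν, Tendsto (fun α => e (X α) ν) l (𝓝 (e Z ν)))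
    (h0 : ∀ᶠ α in l, 0 ≤ X α) (hM : ∀ᶠ α in l, ‖X α‖ ≤ M) : 0 ≤ Z := by
  have hM0 : 0 ≤ M := by
    obtain ⟨α, hα⟩ := hM.exists
    exact (norm_nonneg _).trans hα
  refine ((norm_sub_half_le_iff hM0).1
    (norm_sub_le_of_tendsto e (by linarith) h ((M / 2) • one 𝔓) ?_)).1
  filter_upwards [h0, hM] with α hα hα'
  exact (norm_sub_half_le_iff hM0).2
    ⟨hα, (le_abs_self _).trans ((norm_le_iff 𝔓 _ hM0).1 hα')⟩

/-- Banach–Alaoglu, along an ultrafilter. -/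
theorem exists_tendsto_predual {I : Type*} (l : Ultrafilter I)
    {X : I → Linfty 𝔓} {M : ℝ} (hM : ∀ᶠ α in l, ‖X α‖ ≤ M) :
    ∃ Z, ∀ ν, Tendsto (fun α => e (X α) ν) l (𝓝 (e Z ν)) := by
  have hcomp := WeakDual.isCompact_closedBall (0 : StrongDual ℝ E) M
  obtain ⟨f, -, hf⟩ := hcomp.ultrafilter_le_nhds
    (l.map fun α => StrongDual.toWeakDual (e (X α))) (by
      refine le_principal_iff.2 (mem_map.2 ?_)
      filter_upwards [hM] with α hα
      simpa using hα)
  refine ⟨e.symm (WeakDual.toStrongDual f), fun ν => ?_⟩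
  have h1 : Tendsto (fun α => StrongDual.toWeakDual (e (X α))) l (𝓝 f) := hf
  rw [e.apply_symm_apply]
  exact ((WeakDual.eval_continuous (𝕜 := ℝ) ν).tendsto f).comp h1

/-- If `L^∞_c` has a predual, decreasing nets that are bounded from below have an infimum, to
which they converge in the weak-star topology. -/
theorem exists_isGLB_tendsto {I : Type*} [Preorder I]
    [IsDirectedOrder I] [Nonempty I] {X : I → Linfty 𝔓} (hX : Antitone X) (h0 : ∀ α, 0 ≤ X α) :
    ∃ Z, IsGLB (range X) Z ∧ ∀ ν, Tendsto (fun α => e (X α) ν) atTop (𝓝 (e Z ν)) := by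
  have bdd : ∀ V : Linfty 𝔓, (∀ α, V ≤ X α) → ∀ β α, β ≤ α → ‖X α - V‖ ≤ ‖X β - V‖ := by
    intro V hV β α h
    refine norm_le_of_abs_le ?_
    rw [abs_of_nonneg (sub_nonneg.2 (hV α))]
    exact sub_le_sub_right (hX h) V
  -- Each ultrafilter limit is a greatest lower bound. Infima are unique, so all ultrafilters finer
  -- than `atTop` give the same limit and the whole net converges.
  have key : ∀ l : Ultrafilter I, (l : Filter I) ≤ atTop → ∃ Z, IsGLB (range X) Z ∧ ∀ ν,
      Tendsto (fun α => e (X α) ν) l (𝓝 (e Z ν)) := by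
    intro l hl
    obtain ⟨β⟩ := ‹Nonempty I›
    obtain ⟨Z, hZ⟩ := exists_tendsto_predual e l (X := X) (M := ‖X β‖) (by
      filter_upwards [hl (eventually_ge_atTop β)] with α hα
      simpa using bdd 0 h0 β α hα)
    refine ⟨Z, ⟨?_, fun V hV => ?_⟩, hZ⟩
    · rintro _ ⟨γ, rfl⟩
      refine sub_nonneg.1 (nonneg_of_tendsto_predual e (l := (l : Filter I))
        (X := fun α => X γ - X α) (M := ‖X γ‖) (fun ν => ?_) ?_ ?_)
      · simpa only [map_sub, sub_apply] using (hZ ν).const_sub (e (X γ) ν)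
      · filter_upwards [hl (eventually_ge_atTop γ)] with α hα
        exact sub_nonneg.2 (hX hα)
      · filter_upwards [hl (eventually_ge_atTop γ)] with α hα
        refine norm_le_of_abs_le ?_
        rw [abs_of_nonneg (sub_nonneg.2 (hX hα))]
        exact sub_le_self _ (h0 α)
    · have hV' : ∀ α, V ≤ X α := fun α => hV ⟨α, rfl⟩
      refine sub_nonneg.1 (nonneg_of_tendsto_predual e (l := (l : Filter I))
        (X := fun α => X α - V) (M := ‖X β - V‖) (fun ν => ?_) ?_ ?_)
      · simpa only [map_sub, sub_apply] using (hZ ν).sub_const (e V ν)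
      · exact Eventually.of_forall fun α => sub_nonneg.2 (hV' α)
      · filter_upwards [hl (eventually_ge_atTop β)] with α hα
        exact bdd V hV' β α hα
  obtain ⟨Z, hZ, -⟩ := key (Ultrafilter.of atTop) (Ultrafilter.of_le _)
  refine ⟨Z, hZ, fun ν => tendsto_iff_ultrafilter _ _ _ |>.2 fun l hl => ?_⟩
  obtain ⟨Z', hZ', h⟩ := key l hl
  rw [hZ.unique hZ']
  exact h ν

theorem orderContinuous_predual (ν : E) : OrderContinuous fun X : Linfty 𝔓 => e X ν := by
  intro I _ _ _ X hX h0
  obtain ⟨Z, hZ, h⟩ := exists_isGLB_tendsto e hX fun α => h0.1 ⟨α, rfl⟩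
  have := h ν
  rwa [hZ.unique h0, map_zero] at this

end Predual

theorem DualIsLinfty.exists_isGLB {Y : Submodule ℝ (baC 𝔓)} (hY : DualIsLinfty Y) {I : Type*}
    [Preorder I] [IsDirectedOrder I] [Nonempty I] {X : I → Linfty 𝔓} (hX : Antitone X)
    (h0 : ∀ α, 0 ≤ X α) : ∃ Z, IsGLB (range X) Z := by
  obtain ⟨E, _, _, e, -⟩ := hY.exists_predual
  obtain ⟨Z, hZ, -⟩ := exists_isGLB_tendsto e hX h0
  exact ⟨Z, hZ⟩

theorem DualIsLinfty.orderContinuous {Y : Submodule ℝ (baC 𝔓)} (hY : DualIsLinfty Y) {ν : baC 𝔓}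
    (hν : ν ∈ Y) : OrderContinuous (integral ν) := by
  obtain ⟨E, _, _, e, j, hj, he⟩ := hY.exists_predual
  obtain ⟨x, rfl⟩ : ν ∈ range j := hj ▸ hν
  simpa only [he] using orderContinuous_predual e x

/-! ### Indicators, and continuous functionals as set functions -/

theorem isPolar_iff {A : Set Ω} : IsPolar 𝔓 A ↔ MeasurableSet A ∧ qsMeasure 𝔓 A = 0 :=
  and_congr_right fun hA => (qsMeasure_eq_zero_iff 𝔓 hA).symm

theorem ae_abs_le_norm (X : Linfty 𝔓) : ∀ᵐ ω ∂(qsMeasure 𝔓), |X ω| ≤ ‖X‖ := by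
  have h := (norm_le_iff 𝔓 X (norm_nonneg X)).1 le_rfl
  rw [← Lp.coeFn_le] at h
  filter_upwards [h, Lp.coeFn_abs X, coeFn_smul_one 𝔓 ‖X‖] with ω a b c
  rwa [b, c] at a

theorem ind_nonneg {A : Set Ω} (hA : MeasurableSet A) : 0 ≤ ind 𝔓 A hA := by
  rw [← Lp.coeFn_nonneg]
  filter_upwards [coeFn_ind 𝔓 hA] with ω h
  rw [h]; exact indicator_nonneg (fun _ _ => zero_le_one) ω

theorem ind_mono {A B : Set Ω} (hA : MeasurableSet A) (hB : MeasurableSet B) (h : A ⊆ B) :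
    ind 𝔓 A hA ≤ ind 𝔓 B hB := by
  rw [← Lp.coeFn_le]
  filter_upwards [coeFn_ind 𝔓 hA, coeFn_ind 𝔓 hB] with ω h1 h2
  rw [h1, h2]
  exact indicator_le_indicator_of_subset h (fun _ => zero_le_one) ω

theorem norm_ind_le {A : Set Ω} (hA : MeasurableSet A) : ‖ind 𝔓 A hA‖ ≤ 1 := by
  rw [norm_le_iff 𝔓 _ zero_le_one, abs_of_nonneg (ind_nonneg hA), ← Lp.coeFn_le]
  filter_upwards [coeFn_ind 𝔓 hA, coeFn_smul_one 𝔓 1] with ω h1 h2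
  rw [h1, h2]
  exact indicator_le_self' (fun _ _ => zero_le_one) ω

theorem ind_union {A B : Set Ω} (hA : MeasurableSet A) (hB : MeasurableSet B)
    (h : Disjoint A B) : ind 𝔓 (A ∪ B) (hA.union hB) = ind 𝔓 A hA + ind 𝔓 B hB := by
  refine Lp.ext ?_
  filter_upwards [coeFn_ind 𝔓 hA, coeFn_ind 𝔓 hB, coeFn_ind 𝔓 (hA.union hB),
    Lp.coeFn_add (ind 𝔓 A hA) (ind 𝔓 B hB)] with ω h1 h2 h3 h4
  rw [h3, h4, Pi.add_apply, h1, h2, indicator_union_of_disjoint h]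

theorem ind_eq_zero {A : Set Ω} (hA : MeasurableSet A) (h : qsMeasure 𝔓 A = 0) :
    ind 𝔓 A hA = 0 := by
  refine Lp.ext ?_
  filter_upwards [coeFn_ind 𝔓 hA, Lp.coeFn_zero ℝ ∞ (qsMeasure 𝔓),
    measure_eq_zero_iff_ae_notMem.1 h] with ω h1 h2 h3
  rw [h1, h2, indicator_of_notMem h3]; rfl

theorem ind_univ : ind 𝔓 univ MeasurableSet.univ = one 𝔓 := by
  refine Lp.ext ?_
  filter_upwards [coeFn_ind 𝔓 MeasurableSet.univ, coeFn_one 𝔓] with ω h1 h2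
  rw [h1, h2, indicator_univ]

/-- Allows index sets in `Type`, such as `Finset ℕ`, by lifting them to the universe fixed in
`OrderContinuous`. -/
theorem OrderContinuous.tendsto {φ : Linfty 𝔓 → ℝ} (hφ : OrderContinuous φ) {I : Type}
    [Preorder I] [IsDirectedOrder I] [Nonempty I] {X : I → Linfty 𝔓} (hX : Antitone X)
    (h : IsGLB (range X) 0) : Tendsto (fun α => φ (X α)) atTop (𝓝 0) := by
  have : IsDirectedOrder (ULift.{u} I) := ⟨fun a b => by
    obtain ⟨c, h1, h2⟩ := exists_ge_ge a.down b.down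
    exact ⟨⟨c⟩, h1, h2⟩⟩
  have h1 := hφ (ULift.{u} I) (fun a => X a.down) (fun a b hab => hX hab) (by
    convert h
    ext x
    simp)
  have h2 : Tendsto (fun a : I => (ULift.up.{u} a)) atTop atTop :=
    tendsto_atTop.2 fun b => eventually_ge_atTop b.down
  exact h1.comp h2

theorem eq_integral {μ : baC 𝔓} {φ : Linfty 𝔓 →L[ℝ] ℝ}
    (h : ∀ A hA, φ (ind 𝔓 A hA) = (μ : BA Ω) A) : φ = integral μ :=
  (existsUnique_integral μ).unique h (integral_ind μ)

theorem integral_injective : Function.Injective (integral : baC 𝔓 → Linfty 𝔓 →L[ℝ] ℝ) := by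
  intro μ ν h
  refine Subtype.ext (BA.ext fun A hA => ?_)
  rw [← integral_ind μ A hA, h, integral_ind]

/-- Every continuous linear functional on `L^∞_c` is the integral with respect to some `μ ∈ ba_c`. -/
theorem exists_integral_eq (φ : Linfty 𝔓 →L[ℝ] ℝ) : ∃ μ : baC 𝔓, integral μ = φ := by
  classical
  set f : Set Ω → ℝ := fun A => if h : MeasurableSet A then φ (ind 𝔓 A h) else 0 with hf
  have hfA : ∀ A (hA : MeasurableSet A), f A = φ (ind 𝔓 A hA) := fun A hA => dif_pos hA
  have hbound : ∀ A, MeasurableSet A → |f A| ≤ ‖φ‖ := fun A hA => by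
    rw [hfA A hA, ← Real.norm_eq_abs]
    refine (φ.le_opNorm _).trans ?_
    exact mul_le_of_le_one_right (norm_nonneg _) (norm_ind_le hA)
  let m : BA Ω := ⟨f, fun A hA => dif_neg hA, fun A B hA hB hAB => by
    rw [hfA _ (hA.union hB), ind_union hA hB hAB, map_add, hfA A hA, hfA B hB], ‖φ‖ + ‖φ‖, by
    rintro r ⟨B, hB, rfl⟩
    have h1 := abs_le.1 (hbound B hB)
    have h2 := abs_le.1 (hbound _ hB.compl)
    linarith⟩
  have hm : ∀ A (hA : MeasurableSet A), m A = φ (ind 𝔓 A hA) := hfA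
  refine ⟨⟨m, fun N hN => (BA.modulus_eq_zero_iff hN.1).2 fun B hB hBN => ?_⟩, ?_⟩
  · rw [hm B hB, ind_eq_zero hB (measure_mono_null hBN (isPolar_iff.1 hN).2), map_zero]
  · exact (eq_integral fun A hA => (hm A hA).symm).symm

/-! ### Order continuous functionals belong to `sca_c` -/

theorem OrderContinuous.isCountablyAdditive {μ : baC 𝔓} (hμ : OrderContinuous (integral μ)) :
    (μ : BA Ω).IsCountablyAdditive := by
  classical
  intro A hA hd
  -- Tails are indexed by finite sets because `HasSum` is unconditional. There are countably many of
  -- them, so a lower bound of their indicators is bounded by all of them outside one polar event.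
  let T : Finset ℕ → Set Ω := fun s => ⋃ i, ⋃ (_ : i ∉ s), A i
  have hT : ∀ s, MeasurableSet (T s) := fun s =>
    MeasurableSet.iUnion fun i => MeasurableSet.iUnion fun _ => hA i
  have hTmono : Antitone T := fun s t hst => iUnion_mono fun i =>
    iUnion_subset fun hi => subset_iUnion (fun _ : i ∉ s => A i) fun h => hi (hst h)
  have hsum : ∀ s, (μ : BA Ω) (⋃ i, A i) = ∑ i ∈ s, (μ : BA Ω) (A i) + (μ : BA Ω) (T s) := by
    intro s
    induction s using Finset.induction_on with
    | empty => simp [T]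
    | insert a s ha ih =>
      have h1 : T s = A a ∪ T (insert a s) := by
        ext ω
        simp only [T, mem_iUnion, mem_union, Finset.mem_insert, not_or, exists_prop]
        constructor
        · rintro ⟨i, hi, hω⟩
          rcases eq_or_ne i a with rfl | h
          · exact Or.inl hω
          · exact Or.inr ⟨i, ⟨h, hi⟩, hω⟩
        · rintro (h | ⟨i, ⟨-, hi⟩, hω⟩)
          · exact ⟨a, ha, h⟩
          · exact ⟨i, hi, hω⟩
      have h2 : Disjoint (A a) (T (insert a s)) := by
        simp only [T, disjoint_iUnion_right]
        intro i hi
        exact hd fun h => hi (h ▸ Finset.mem_insert_self _ _)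
      rw [Finset.sum_insert ha, ih, h1, (μ : BA Ω).union (hA a) (hT _) h2]
      ring
  have hlim := hμ.tendsto (X := fun s => ind 𝔓 (T s) (hT s))
    (fun s t hst => ind_mono _ _ (hTmono hst)) ⟨by
      rintro _ ⟨s, rfl⟩
      exact ind_nonneg _, fun U hU => by
      have hU' : ∀ᵐ ω ∂(qsMeasure 𝔓), ∀ s, U ω ≤ (T s).indicator (fun _ => (1 : ℝ)) ω := by
        refine ae_all_iff.2 fun s => ?_
        have h := hU ⟨s, rfl⟩
        rw [← Lp.coeFn_le] at h
        filter_upwards [h, coeFn_ind 𝔓 (hT s)] with ω a b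
        rwa [b] at a
      rw [← Lp.coeFn_le]
      filter_upwards [hU', Lp.coeFn_zero ℝ ∞ (qsMeasure 𝔓)] with ω h h0
      rw [h0, Pi.zero_apply]
      obtain ⟨s, hs⟩ : ∃ s, ω ∉ T s := by
        by_cases hω : ∃ i, ω ∈ A i
        · obtain ⟨i, hi⟩ := hω
          refine ⟨{i}, ?_⟩
          simp only [T, mem_iUnion, not_exists, Finset.mem_singleton]
          intro j hj hωj
          exact (hd hj).le_bot ⟨hωj, hi⟩
        · refine ⟨∅, ?_⟩
          simp only [T, mem_iUnion, not_exists]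
          exact fun j _ hj => hω ⟨j, hj⟩
      simpa [hs] using h s⟩
  simp only [integral_ind] at hlim
  have := (tendsto_const_nhds (x := (μ : BA Ω) (⋃ i, A i))).sub hlim
  rw [sub_zero] at this
  refine this.congr fun s => ?_
  rw [hsum s]; ring

/-- The `|μ|`-null events are directed under union. The infimum `g` of the indicators of their
complements marks what remains after all of them, uncountably many perhaps, are removed; the support
is `{g > 0}`. -/
theorem OrderContinuous.isSupported {μ : baC 𝔓} (hμ : OrderContinuous (integral μ))
    (hD : ∀ (I : Type u) [Preorder I] [IsDirectedOrder I] [Nonempty I] (X : I → Linfty 𝔓),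
      Antitone X → (∀ α, 0 ≤ X α) → ∃ Z, IsGLB (range X) Z) :
    (μ : BA Ω).IsSupported 𝔓 := by
  let I := {A : Set Ω // MeasurableSet A ∧ ∀ B, MeasurableSet B → B ⊆ A → (μ : BA Ω) B = 0}
  have hdir : IsDirectedOrder I := ⟨fun A A' => by
    refine ⟨⟨A.1 ∪ A'.1, A.2.1.union A'.2.1, fun B hB hBA => ?_⟩, subset_union_left,
      subset_union_right⟩
    rw [← inter_union_sdiff B A.1, (μ : BA Ω).union (hB.inter A.2.1) (hB.diff A.2.1)
      (disjoint_sdiff_right.mono_left inter_subset_right), A.2.2 _ (hB.inter A.2.1)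
      inter_subset_right, A'.2.2 _ (hB.diff A.2.1), add_zero]
    exact fun ω hω => (hBA hω.1).resolve_left hω.2⟩
  let i0 : I := ⟨∅, MeasurableSet.empty, fun B _ hB => by
    rw [subset_empty_iff.1 hB, BA.empty]⟩
  have : Nonempty I := ⟨i0⟩
  obtain ⟨g, hg⟩ := hD I (fun A => ind 𝔓 A.1ᶜ A.2.1.compl)
    (fun A A' h => ind_mono _ _ (compl_subset_compl.2 h)) (fun A => ind_nonneg _)
  have hgm : Measurable g := (Lp.stronglyMeasurable g).measurable
  have hS : MeasurableSet {ω | 0 < g ω} := measurableSet_lt measurable_const hgm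
  refine ⟨{ω | 0 < g ω}, hS, (BA.modulus_eq_zero_iff hS.compl).2 fun B hB hBS => ?_,
    fun N hN hN0 => ?_⟩
  -- The indicators of `B \ A` decrease to 0: a lower bound is at most `g ≤ 0` on `B`, and at most 0
  -- off `B`. Since `μ (B \ A) = μ B` for each null `A`, the limit is the constant `μ B`.
  · have hlim := hμ I (fun A => ind 𝔓 (B \ A.1) (hB.diff A.2.1))
      (fun A A' h => ind_mono _ _ (sdiff_subset_sdiff_right h)) ⟨by
        rintro _ ⟨A, rfl⟩
        exact ind_nonneg _, fun U hU => by
        have h1 : g ⊔ U ≤ g := hg.2 (by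
          rintro _ ⟨A, rfl⟩
          exact sup_le (hg.1 ⟨A, rfl⟩)
            ((hU ⟨A, rfl⟩).trans (ind_mono _ _ fun ω hω => hω.2)))
        have h2 : U ≤ g := le_sup_right.trans h1
        have h3 := hU ⟨i0, rfl⟩
        rw [← Lp.coeFn_le] at h2 h3 ⊢
        filter_upwards [h2, h3, coeFn_ind 𝔓 (hB.diff i0.2.1),
          Lp.coeFn_zero ℝ ∞ (qsMeasure 𝔓)] with ω a b c d
        rw [d, Pi.zero_apply]
        by_cases hω : ω ∈ B
        · exact a.trans (not_lt.1 (hBS hω))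
        · rw [c, indicator_of_notMem fun h => hω h.1] at b
          exact b⟩
    refine tendsto_nhds_unique (tendsto_const_nhds.congr fun A => ?_) hlim
    rw [integral_ind]
    conv_lhs => rw [← inter_union_sdiff B A.1]
    rw [(μ : BA Ω).union (hB.inter A.2.1) (hB.diff A.2.1)
      (disjoint_sdiff_right.mono_left inter_subset_right),
      A.2.2 _ (hB.inter A.2.1) inter_subset_right, zero_add]
  · have hNS := hN.inter hS
    -- This null event is itself an index, so `g ≤ 0` q.s. on it, although `g > 0` there.
    let A : I := ⟨N ∩ {ω | 0 < g ω}, hNS, (BA.modulus_eq_zero_iff hNS).1 hN0⟩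
    refine isPolar_iff.2 ⟨hNS, measure_eq_zero_iff_ae_notMem.2 ?_⟩
    have h1 : g ≤ ind 𝔓 A.1ᶜ A.2.1.compl := hg.1 ⟨A, rfl⟩
    rw [← Lp.coeFn_le] at h1
    filter_upwards [h1, coeFn_ind 𝔓 A.2.1.compl] with ω a b hω
    rw [b, indicator_of_notMem fun h : ω ∈ A.1ᶜ => h hω] at a
    exact absurd hω.2 (not_lt.2 a)

theorem OrderContinuous.mem_scaC {μ : baC 𝔓} (hμ : OrderContinuous (integral μ))
    {Y : Submodule ℝ (baC 𝔓)} (hY : DualIsLinfty Y) : μ ∈ scaC 𝔓 :=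
  ⟨hμ.isCountablyAdditive, hμ.isSupported fun _ _ _ _ _ hX h0 => hY.exists_isGLB hX h0⟩

theorem DualIsLinfty.le_scaC {Y : Submodule ℝ (baC 𝔓)} (hY : DualIsLinfty Y) : Y ≤ scaC 𝔓 :=
  fun _ hν => (hY.orderContinuous hν).mem_scaC hY

/-! ### Expectations under supported probability measures -/

theorem absolutelyContinuous_of_eq_real {μ : baC 𝔓} {Q : Measure Ω} [IsFiniteMeasure Q]
    (h : ∀ A, MeasurableSet A → (μ : BA Ω) A = Q.real A) : Q ≪ qsMeasure 𝔓 := by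
  refine Measure.AbsolutelyContinuous.mk fun N hN hN0 => ?_
  have hp : IsPolar 𝔓 N := isPolar_iff.2 ⟨hN, hN0⟩
  have := (BA.modulus_eq_zero_iff hN).1 (μ.2 N hp) N hN subset_rfl
  rwa [h N hN, measureReal_eq_zero_iff] at this

theorem integrable_of_absolutelyContinuous {Q : Measure Ω} [IsFiniteMeasure Q]
    (hQ : Q ≪ qsMeasure 𝔓) (X : Linfty 𝔓) : Integrable X Q :=
  Integrable.of_bound (Lp.stronglyMeasurable X).aestronglyMeasurable ‖X‖
    (hQ.ae_le (ae_abs_le_norm X))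

/-- Expectation is a continuous functional with the right values on indicators, and only one such
functional exists. -/
theorem integral_eq_expectation {μ : baC 𝔓} {Q : Measure Ω} [IsFiniteMeasure Q]
    (h : ∀ A, MeasurableSet A → (μ : BA Ω) A = Q.real A) (X : Linfty 𝔓) :
    integral μ X = ∫ ω, X ω ∂Q := by
  have hQ := absolutelyContinuous_of_eq_real h
  let f : Linfty 𝔓 →ₗ[ℝ] ℝ :=
    { toFun := fun X => ∫ ω, X ω ∂Q
      map_add' := fun X Y => by
        rw [← integral_add (integrable_of_absolutelyContinuous hQ X)
          (integrable_of_absolutelyContinuous hQ Y)]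
        exact integral_congr_ae (hQ.ae_le (Lp.coeFn_add X Y))
      map_smul' := fun c X => by
        rw [RingHom.id_apply, smul_eq_mul, ← integral_const_mul]
        exact integral_congr_ae (hQ.ae_le (Lp.coeFn_smul c X)) }
  let φ : Linfty 𝔓 →L[ℝ] ℝ := f.mkContinuous (Q.real univ) fun X => by
    rw [mul_comm]
    exact norm_integral_le_of_norm_le_const (hQ.ae_le (ae_abs_le_norm X))
  have hφ : φ = integral μ := eq_integral fun A hA => by
    have h1 : φ (ind 𝔓 A hA) = ∫ ω, A.indicator (fun _ => (1 : ℝ)) ω ∂Q :=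
      integral_congr_ae (hQ.ae_le (coeFn_ind 𝔓 hA))
    rw [h1, h A hA, integral_indicator_const _ hA]; simp
  rw [← hφ]; rfl

theorem integral_nonneg_of_eq_real {μ : baC 𝔓} {Q : Measure Ω} [IsFiniteMeasure Q]
    (h : ∀ A, MeasurableSet A → (μ : BA Ω) A = Q.real A) {X : Linfty 𝔓} (hX : 0 ≤ X) :
    0 ≤ integral μ X := by
  rw [integral_eq_expectation h]
  rw [← Lp.coeFn_nonneg] at hX
  exact integral_nonneg_of_ae ((absolutelyContinuous_of_eq_real h).ae_le hX)

theorem exists_supportedProb {μ : baC 𝔓} (hμ : μ ∈ scaC 𝔓)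
    (h0 : ∀ A, MeasurableSet A → 0 ≤ (μ : BA Ω) A) (h1 : (μ : BA Ω) univ = 1) :
    ∃ Q ∈ SupportedProb 𝔓, ∀ A, MeasurableSet A → (μ : BA Ω) A = (Q : Measure Ω).real A := by
  set s := BA.toSigned (μ : BA Ω) hμ.1
  have hs : 0 ≤[univ] s :=
    VectorMeasure.restrict_le_restrict_of_subset_le _ _ fun A hA _ => h0 A hA
  set Q := s.toMeasureOfZeroLE univ MeasurableSet.univ hs
  have hQ : ∀ A, MeasurableSet A → (μ : BA Ω) A = Q.real A := fun A hA => by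
    rw [SignedMeasure.toMeasureOfZeroLE_real_apply _ _ _ hA, univ_inter]; rfl
  have hprob : IsProbabilityMeasure Q := by
    refine ⟨?_⟩
    have := hQ univ MeasurableSet.univ
    rw [h1, measureReal_def] at this
    rw [← ENNReal.ofReal_toReal (measure_ne_top Q univ), ← this, ENNReal.ofReal_one]
  exact ⟨⟨Q, hprob⟩, ⟨μ, hμ, hQ⟩, hQ⟩

/-- The point of a support: what holds `Q`-a.s. holds q.s. on `S`. -/
theorem exists_support {Q : ProbabilityMeasure Ω} (hQ : Q ∈ SupportedProb 𝔓) :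
    ∃ S, MeasurableSet S ∧ (Q : Measure Ω) Sᶜ = 0 ∧
      (qsMeasure 𝔓).restrict S ≪ (Q : Measure Ω) := by
  obtain ⟨μ, ⟨-, S, hS, hS0, hSp⟩, h⟩ := hQ
  have hz : ∀ A, MeasurableSet A → ((μ : BA Ω) A = 0 ↔ (Q : Measure Ω) A = 0) := fun A hA => by
    rw [h A hA, measureReal_eq_zero_iff]
  refine ⟨S, hS, (hz _ hS.compl).1 ((BA.modulus_eq_zero_iff hS.compl).1 hS0 _ hS.compl subset_rfl),
    Measure.AbsolutelyContinuous.mk fun N hN hN0 => ?_⟩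
  rw [Measure.restrict_apply hN]
  refine (isPolar_iff.1 (hSp N hN ((BA.modulus_eq_zero_iff (hN.inter hS)).2 fun B hB hBN => ?_))).2
  exact (hz B hB).2 (measure_mono_null (hBN.trans inter_subset_left) hN0)

/-- Integration with respect to a supported probability measure is order continuous. -/
theorem orderContinuous_expectation {Q : ProbabilityMeasure Ω} (hQ : Q ∈ SupportedProb 𝔓) :
    OrderContinuous fun X : Linfty 𝔓 => ∫ ω, X ω ∂(Q : Measure Ω) := by
  intro I _ _ _ X hX hglb
  obtain ⟨S, hS, hQS, hres⟩ := exists_support hQ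
  obtain ⟨μ, -, hμ⟩ := hQ
  have hac := absolutelyContinuous_of_eq_real hμ
  set q : Measure Ω := (Q : Measure Ω)
  have hmeas : ∀ α, Measurable (X α) := fun α => (Lp.stronglyMeasurable (X α)).measurable
  have hpos : ∀ α, ∀ᵐ ω ∂(qsMeasure 𝔓), 0 ≤ X α ω := fun α =>
    (Lp.coeFn_nonneg _).2 (hglb.1 ⟨α, rfl⟩)
  have hle : ∀ α β, α ≤ β → ∀ᵐ ω ∂(qsMeasure 𝔓), X β ω ≤ X α ω := fun α β h =>
    (Lp.coeFn_le _ _).2 (hX h)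
  set F : I → Ω → ℝ≥0∞ := fun α ω => ENNReal.ofReal (X α ω) with hF
  have hFm : ∀ α, Measurable (F α) := fun α => (hmeas α).ennreal_ofReal
  have hFle : ∀ α β, α ≤ β → F β ≤ᵐ[q] F α := fun α β h => by
    filter_upwards [hac.ae_le (hle α β h)] with ω hω
    exact ENNReal.ofReal_le_ofReal hω
  set i := ⨅ α, ∫⁻ ω, F α ω ∂q with hi
  have hanti : Antitone fun α => ∫⁻ ω, F α ω ∂q := fun α β h => lintegral_mono_ae (hFle α β h)
  have hfin : ∀ α, ∫⁻ ω, F α ω ∂q ≠ ∞ := fun α =>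
    (integrable_of_absolutelyContinuous hac (X α)).lintegral_lt_top.ne
  have hi0 : i = 0 := by
    -- An increasing sequence of indices whose integrals tend to the infimum `i` reduces the net to
    -- a sequence. Its pointwise infimum `z` has integral `i`.
    obtain ⟨v, -, hv, hvm⟩ := exists_seq_tendsto_sInf
      (range_nonempty fun α => ∫⁻ ω, F α ω ∂q) (OrderBot.bddBelow _)
    choose a ha using hvm
    choose ub hub1 hub2 using fun α β : I => exists_ge_ge α β
    let s : ℕ → I := fun n => Nat.rec (a 0) (fun n b => ub b (a (n + 1))) n
    have hs : ∀ n, s n ≤ s (n + 1) := fun n => hub1 _ _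
    have has : ∀ n, a n ≤ s n := fun n => by
      cases n with
      | zero => exact le_rfl
      | succ n => exact hub2 _ _
    set z : Ω → ℝ≥0∞ := fun ω => ⨅ n, F (s n) ω with hz
    have hzm : Measurable z := Measurable.iInf fun n => hFm (s n)
    have hzi : ∫⁻ ω, z ω ∂q = i := by
      rw [hz, lintegral_iInf_ae (fun n => hFm (s n)) (fun n => hFle _ _ (hs n)) (hfin _)]
      refine le_antisymm (ge_of_tendsto' hv fun n => ?_) (le_iInf fun n => iInf_le _ _)
      rw [← ha n]
      exact (iInf_le _ n).trans (hanti (has n))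
    -- `z` is an essential infimum of the whole net: replacing it by `min z (F γ)` cannot lower its
    -- integral below `i`.
    have hzX : ∀ γ, z ≤ᵐ[q] F γ := by
      intro γ
      have h1 : ∫⁻ ω, z ω ∂q ≤ ∫⁻ ω, min (z ω) (F γ ω) ∂q := by
        have h2 : (fun ω => min (z ω) (F γ ω)) = fun ω => ⨅ n, min (F (s n) ω) (F γ ω) := by
          funext ω
          exact iInf_inf
        rw [h2, lintegral_iInf_ae (fun n => (hFm (s n)).min (hFm γ)) (fun n => by
          filter_upwards [hFle _ _ (hs n)] with ω hω
          exact min_le_min_right _ hω)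
          (ne_top_of_le_ne_top (hfin γ) (lintegral_mono fun ω => min_le_right _ _)), hzi]
        refine le_iInf fun n => ?_
        refine (iInf_le _ (ub (s n) γ)).trans (lintegral_mono_ae ?_)
        filter_upwards [hFle _ _ (hub1 (s n) γ), hFle _ _ (hub2 (s n) γ)] with ω h3 h4
        exact le_min h3 h4
      have h3 := ae_eq_of_ae_le_of_lintegral_le (f := fun ω => min (z ω) (F γ ω)) (g := z)
        (Eventually.of_forall fun ω => min_le_left _ _)
        (ne_top_of_le_ne_top (hfin γ) (lintegral_mono fun ω => min_le_right _ _))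
        hzm.aemeasurable h1
      filter_upwards [h3] with ω hω
      exact hω ▸ min_le_right _ _
    -- Cutting `z` off at 1 and outside `S` gives a bounded function that lies q.s. below the net,
    -- as the support turns `Q`-a.s. bounds into q.s. ones. Hence `g ≤ 0`, which forces `z = 0`
    -- `Q`-a.s.
    let g : Ω → ℝ := S.indicator fun ω => (min (z ω) 1).toReal
    have hgm : Measurable g := (hzm.min measurable_const).ennreal_toReal.indicator hS
    have hg1 : ∀ ω, (min (z ω) 1).toReal ≤ 1 := fun ω =>
      ENNReal.toReal_mono ENNReal.one_ne_top (min_le_right _ _)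
    have hg : MemLp g ∞ (qsMeasure 𝔓) := by
      refine memLp_top_of_bound hgm.aestronglyMeasurable 1 (Eventually.of_forall fun ω => ?_)
      by_cases hω : ω ∈ S
      · simp only [g, indicator_of_mem hω, Real.norm_eq_abs, abs_of_nonneg ENNReal.toReal_nonneg]
        exact hg1 ω
      · simp [g, hω]
    have hg0 : hg.toLp g ≤ 0 := hglb.2 (by
      rintro _ ⟨γ, rfl⟩
      rw [← Lp.coeFn_le]
      filter_upwards [hg.coeFn_toLp, (ae_restrict_iff' hS).1 (hres.ae_le (hzX γ)), hpos γ]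
        with ω h1 h2 h3
      rw [h1]
      by_cases hω : ω ∈ S
      · simp only [g, indicator_of_mem hω]
        exact ENNReal.toReal_le_of_le_ofReal h3 ((min_le_left _ _).trans (h2 hω))
      · simpa [g, hω] using h3)
    rw [← hzi, lintegral_eq_zero_iff hzm]
    rw [← Lp.coeFn_le] at hg0
    filter_upwards [hac.ae_le hg0, hac.ae_le hg.coeFn_toLp,
      hac.ae_le (Lp.coeFn_zero ℝ ∞ (qsMeasure 𝔓)), measure_eq_zero_iff_ae_notMem.1 hQS]
      with ω h1 h2 h3 h4
    rw [h2, h3, Pi.zero_apply] at h1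
    have hω : ω ∈ S := not_not.1 h4
    simp only [g, indicator_of_mem hω] at h1
    have h5 := le_antisymm h1 ENNReal.toReal_nonneg
    rw [ENNReal.toReal_eq_zero_iff] at h5
    rcases h5 with h5 | h5
    · rcases min_choice (z ω) 1 with h6 | h6
      · exact h6 ▸ h5
      · exact absurd (h6 ▸ h5) one_ne_zero
    · exact absurd h5 (ne_top_of_le_ne_top ENNReal.one_ne_top (min_le_right _ _))
  have hlim := tendsto_atTop_iInf hanti
  rw [← hi, hi0] at hlim
  have hlim' := (ENNReal.tendsto_toReal ENNReal.zero_ne_top).comp hlim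
  rw [ENNReal.toReal_zero] at hlim'
  refine hlim'.congr fun α => ?_
  exact (integral_eq_lintegral_of_nonneg_ae (hac.ae_le (hpos α))
    (hmeas α).aestronglyMeasurable).symm

/-! ### Supported probabilities span `sca_c` -/

/-- If `S` supports `μ`, then `S ∩ E` supports the restriction to `E`. This makes both parts of a
Hahn decomposition elements of `sca_c`. -/
theorem exists_restriction_mem_scaC {μ : baC 𝔓} (hμ : μ ∈ scaC 𝔓) {E : Set Ω}
    (hE : MeasurableSet E) :
    ∃ ν ∈ scaC 𝔓, ∀ A, MeasurableSet A → (ν : BA Ω) A = (μ : BA Ω) (A ∩ E) := by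
  classical
  set f : Set Ω → ℝ := fun A => if MeasurableSet A then (μ : BA Ω) (A ∩ E) else 0 with hf
  have hfA : ∀ A, MeasurableSet A → f A = (μ : BA Ω) (A ∩ E) := fun A hA => if_pos hA
  have hbound : ∀ A, MeasurableSet A → |(μ : BA Ω) A| ≤ ‖(μ : BA Ω)‖ := fun A hA => by
    have h1 := (μ : BA Ω).le_norm hA
    have h2 := (μ : BA Ω).le_norm hA.compl
    have h3 := (μ : BA Ω).le_norm MeasurableSet.univ
    have h4 := (μ : BA Ω).le_norm MeasurableSet.empty
    have h5 := (μ : BA Ω).apply_univ hA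
    rw [compl_compl] at h2
    rw [compl_univ, BA.empty] at h3
    rw [compl_empty, BA.empty] at h4
    rw [abs_le]
    constructor <;> linarith
  let m : BA Ω := ⟨f, fun A hA => if_neg hA, fun A B hA hB hAB => by
    rw [hfA _ (hA.union hB), hfA A hA, hfA B hB, union_inter_distrib_right,
      (μ : BA Ω).union (hA.inter hE) (hB.inter hE)
        (hAB.mono inter_subset_left inter_subset_left)],
    ‖(μ : BA Ω)‖ + ‖(μ : BA Ω)‖, by
    rintro r ⟨B, hB, rfl⟩
    rw [hfA B hB, hfA _ hB.compl]
    have h1 := abs_le.1 (hbound _ (hB.inter hE))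
    have h2 := abs_le.1 (hbound _ (hB.compl.inter hE))
    linarith⟩
  have hm : ∀ A, MeasurableSet A → m A = (μ : BA Ω) (A ∩ E) := hfA
  have hmem : m ∈ baC 𝔓 := fun N hN => (BA.modulus_eq_zero_iff hN.1).2 fun B hB hBN => by
    rw [hm B hB]
    exact (BA.modulus_eq_zero_iff hN.1).1 (μ.2 N hN) _ (hB.inter hE)
      (inter_subset_left.trans hBN)
  obtain ⟨hca, S, hS, hS0, hSp⟩ := hμ
  refine ⟨⟨m, hmem⟩, ⟨fun A hA hd => ?_, S ∩ E, hS.inter hE, ?_, fun N hN hN0 => ?_⟩, hm⟩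
  · have := hca (fun i => A i ∩ E) (fun i => (hA i).inter hE)
      fun i j hij => (hd hij).mono inter_subset_left inter_subset_left
    rw [← iUnion_inter] at this
    simpa only [hm _ (hA _), hm _ (MeasurableSet.iUnion hA)] using this
  · refine (BA.modulus_eq_zero_iff (hS.inter hE).compl).2 fun B hB hBS => ?_
    rw [hm B hB]
    exact (BA.modulus_eq_zero_iff hS.compl).1 hS0 _ (hB.inter hE)
      fun ω hω hωS => hBS hω.1 ⟨hωS, hω.2⟩
  · have hset : N ∩ (S ∩ E) = N ∩ E ∩ S := by
      rw [inter_comm S, ← inter_assoc]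
    rw [hset] at hN0 ⊢
    refine hSp _ (hN.inter hE) ((BA.modulus_eq_zero_iff ((hN.inter hE).inter hS)).2
      fun B hB hBN => ?_)
    have := (BA.modulus_eq_zero_iff ((hN.inter hE).inter hS)).1 hN0 B hB hBN
    rw [hm B hB] at this
    rwa [inter_eq_left.2 fun ω hω => (hBN hω).1.2] at this

/-- A subspace that contains all supported probability measures contains `sca_c`. -/
theorem scaC_le_of_supportedProb {Y : Submodule ℝ (baC 𝔓)}
    (h : ∀ Q ∈ SupportedProb 𝔓, ∀ ν : baC 𝔓,
      (∀ A, MeasurableSet A → (ν : BA Ω) A = (Q : Measure Ω).real A) → ν ∈ Y) :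
    scaC 𝔓 ≤ Y := by
  have hpos : ∀ ν ∈ scaC 𝔓, (∀ A, MeasurableSet A → 0 ≤ (ν : BA Ω) A) → ν ∈ Y := by
    intro ν hν h0
    rcases (h0 univ MeasurableSet.univ).eq_or_lt with h1 | h1
    · have : ν = 0 := by
        refine Subtype.ext (BA.ext fun A hA => ?_)
        have h2 := (ν : BA Ω).apply_univ hA
        have h3 := h0 A hA
        have h4 := h0 _ hA.compl
        change (ν : BA Ω) A = 0
        linarith
      rw [this]; exact Y.zero_mem
    · set t := (ν : BA Ω) univ
      have hν' : ∀ A, ((t⁻¹ • ν : baC 𝔓) : BA Ω) A = t⁻¹ * (ν : BA Ω) A := fun A => rfl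
      obtain ⟨Q, hQ, hQν⟩ := exists_supportedProb ((scaC 𝔓).smul_mem t⁻¹ hν)
        (fun A hA => by rw [hν']; exact mul_nonneg (inv_nonneg.2 h1.le) (h0 A hA))
        (by rw [hν']; exact inv_mul_cancel₀ h1.ne')
      have := Y.smul_mem t (h Q hQ _ hQν)
      rwa [smul_smul, mul_inv_cancel₀ h1.ne', one_smul] at this
  intro μ hμ
  -- Hahn decomposition: `μ` is a difference of two positive elements of `sca_c`, each zero or a
  -- multiple of a supported probability.
  obtain ⟨E, hE, hE0, hE1⟩ :=
    SignedMeasure.exists_compl_positive_negative (BA.toSigned (μ : BA Ω) hμ.1)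
  obtain ⟨μ₁, hμ₁, h1⟩ := exists_restriction_mem_scaC hμ hE
  obtain ⟨μ₂, hμ₂, h2⟩ := exists_restriction_mem_scaC hμ hE.compl
  have h3 : μ = μ₁ - (-1 : ℝ) • μ₂ := by
    refine Subtype.ext (BA.ext fun A hA => ?_)
    have : ((μ₁ - (-1 : ℝ) • μ₂ : baC 𝔓) : BA Ω) A = (μ₁ : BA Ω) A - (-1) * (μ₂ : BA Ω) A := rfl
    rw [this, h1 A hA, h2 A hA]
    conv_lhs => rw [← inter_union_sdiff A E]
    rw [(μ : BA Ω).union (hA.inter hE) (hA.diff hE)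
      (disjoint_sdiff_right.mono_left inter_subset_right), Set.sdiff_eq]
    ring
  rw [h3]
  refine Y.sub_mem (hpos μ₁ hμ₁ fun A hA => ?_)
    (hpos _ ((scaC 𝔓).smul_mem (-1) hμ₂) fun A hA => ?_)
  · rw [h1 A hA]
    exact (VectorMeasure.restrict_le_restrict_iff _ _ hE).1 hE0 (hA.inter hE) inter_subset_right
  · have h4 : (μ : BA Ω) (A ∩ Eᶜ) ≤ 0 := (VectorMeasure.restrict_le_restrict_iff _ _ hE.compl).1
      hE1 (hA.inter hE.compl) inter_subset_right
    change 0 ≤ (-1) * (μ₂ : BA Ω) A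
    rw [h2 A hA]
    linarith

/-! ### Fatou property of representable risk measures, and `Y = sca_c` -/

theorem integral_add_left (μ ν : baC 𝔓) (X : Linfty 𝔓) :
    integral (μ + ν) X = integral μ X + integral ν X := by
  rw [← eq_integral (μ := μ + ν) (φ := integral μ + integral ν) fun A hA => ?_]
  · rfl
  · rw [add_apply, integral_ind, integral_ind]; rfl

theorem integral_smul_left (a : ℝ) (μ : baC 𝔓) (X : Linfty 𝔓) :
    integral (a • μ) X = a * integral μ X := by
  rw [← eq_integral (μ := a • μ) (φ := a • integral μ) fun A hA => ?_]
  · rfl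
  · rw [smul_apply, integral_ind]; rfl

theorem integral_one (μ : baC 𝔓) : integral μ (one 𝔓) = (μ : BA Ω) univ := by
  rw [← ind_univ, integral_ind]

theorem tendsto_expectation {Q : ProbabilityMeasure Ω} (hQ : Q ∈ SupportedProb 𝔓) {I : Type u}
    [Preorder I] [IsDirectedOrder I] [Nonempty I] {X : I → Linfty 𝔓} {X₀ : Linfty 𝔓}
    (h : OrderConverges X X₀) :
    Tendsto (fun α => ∫ ω, X α ω ∂(Q : Measure Ω)) atTop (𝓝 (∫ ω, X₀ ω ∂(Q : Measure Ω))) := by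
  obtain ⟨D, hD, hD0, hXD⟩ := h
  have hlim := orderContinuous_expectation hQ I D hD hD0
  obtain ⟨ν, -, hν⟩ := hQ
  simp only [← integral_eq_expectation hν] at hlim ⊢
  rw [tendsto_iff_dist_tendsto_zero]
  refine squeeze_zero (fun _ => dist_nonneg) (fun α => ?_) hlim
  rw [Real.dist_eq, ← map_sub, abs_le]
  obtain ⟨h1, h2⟩ := abs_le'.1 (hXD α)
  have h3 := integral_nonneg_of_eq_real hν (sub_nonneg.2 h1)
  have h4 := integral_nonneg_of_eq_real hν (sub_nonneg.2 h2)
  rw [map_sub] at h3 h4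
  rw [map_neg] at h4
  constructor <;> linarith

theorem HasSupportedRepresentation.fatouProperty {ρ : Linfty 𝔓 → ℝ}
    (h : HasSupportedRepresentation ρ) : FatouProperty ρ := by
  obtain ⟨β, ⟨b, hb⟩, -, hρ⟩ := h
  intro I _ _ _ X X₀ hX
  rw [hρ X₀]
  refine iSup_le fun Q => ?_
  have hle : ∀ α, ((∫ ω, X α ω ∂((Q : ProbabilityMeasure Ω) : Measure Ω) : ℝ) : EReal) - β Q
      ≤ (ρ (X α) : EReal) := fun α => by
    rw [hρ (X α)]
    exact le_iSup (fun Q : SupportedProb 𝔓 =>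
      ((∫ ω, X α ω ∂((Q : ProbabilityMeasure Ω) : Measure Ω) : ℝ) : EReal) - β Q) Q
  generalize hβ : β Q = t at hle
  induction t with
  | bot => exact absurd (hb Q) (by simp [hβ])
  | top => simp
  | coe t =>
    have hlim := (continuous_coe_real_ereal.tendsto _).comp
      ((tendsto_expectation Q.2 hX).sub_const t)
    rw [← EReal.coe_sub, ← hlim.liminf_eq]
    refine liminf_le_liminf (Eventually.of_forall fun α => ?_)
    simpa using hle α

theorem isConvexRiskMeasure_integral {ν : baC 𝔓} {Q : ProbabilityMeasure Ω}
    (h : ∀ A, MeasurableSet A → (ν : BA Ω) A = (Q : Measure Ω).real A) :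
    IsConvexRiskMeasure (integral ν) where
  convex := (integral ν).toLinearMap.convexOn convex_univ
  mono X Y hXY := by
    have := integral_nonneg_of_eq_real h (sub_nonneg.2 hXY)
    rw [map_sub] at this
    linarith
  cash_additive X m := by
    rw [map_add, map_smul, integral_one, h univ MeasurableSet.univ, probReal_univ]
    simp

theorem mem_of_hasDualRepresentation {Y : Submodule ℝ (baC 𝔓)} {ν : baC 𝔓}
    (h : HasDualRepresentation Y (integral ν)) : ν ∈ Y := by
  obtain ⟨γ, ⟨b, hb⟩, ⟨μ, hμ⟩, hγ⟩ := h
  have hle : ∀ X, ((integral (μ : baC 𝔓) X : ℝ) : EReal) - γ μ ≤ (integral ν X : ℝ) := fun X => by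
    rw [hγ X]
    exact le_iSup (fun μ : Y => ((integral (μ : baC 𝔓) X : ℝ) : EReal) - γ μ) μ
  have hb' := hb μ
  generalize γ μ = t at hle hμ hb'
  induction t with
  | bot => simp at hb'
  | top => exact absurd rfl hμ
  | coe t =>
    have hle' : ∀ X, integral (μ : baC 𝔓) X - integral ν X ≤ t := fun X => by
      have := hle X
      rw [← EReal.coe_sub, EReal.coe_le_coe_iff] at this
      linarith
    have heq : integral (μ : baC 𝔓) = integral ν := by
      ext X
      by_contra hne
      have hne' : integral (μ : baC 𝔓) X - integral ν X ≠ 0 := sub_ne_zero.2 hne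
      -- Scaling makes the difference equal to `t + 1`, above its bound `t`: a linear functional
      -- bounded above vanishes.
      have := hle' (((t + 1) / (integral (μ : baC 𝔓) X - integral ν X)) • X)
      rw [map_smul, map_smul, ← smul_sub, smul_eq_mul, div_mul_cancel₀ _ hne'] at this
      linarith
    exact integral_injective heq ▸ μ.2

/-- The expectations under supported probabilities serve as test risk measures. -/
theorem DualIsLinfty.eq_scaC {Y : Submodule ℝ (baC 𝔓)} (hY : DualIsLinfty Y)
    (h : ∀ ρ : Linfty 𝔓 → ℝ, IsConvexRiskMeasure ρ → FatouProperty ρ → HasDualRepresentation Y ρ) :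
    Y = scaC 𝔓 := by
  refine le_antisymm hY.le_scaC (scaC_le_of_supportedProb fun Q hQ ν hν => ?_)
  refine mem_of_hasDualRepresentation (h _ (isConvexRiskMeasure_integral hν) ?_)
  intro I _ _ _ X X₀ hX
  have hlim := tendsto_expectation hQ hX
  simp only [← integral_eq_expectation hν] at hlim
  exact ((continuous_coe_real_ereal.tendsto _).comp hlim).liminf_eq.ge

/-! ### Weak-star closedness of bounded parts of sublevel sets -/

theorem FatouProperty.le_of_antitone {ρ : Linfty 𝔓 → ℝ} (hρ : FatouProperty ρ) {I : Type u}
    [Preorder I] [IsDirectedOrder I] [Nonempty I] {X : Linfty 𝔓} {D : I → Linfty 𝔓}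
    (hD : Antitone D) (hD0 : IsGLB (range D) 0) {c : ℝ} (h : ∀ α, ρ (X - D α) ≤ c) : ρ X ≤ c := by
  have h1 := hρ I (fun α => X - D α) X ⟨D, hD, hD0, fun α => by
    rw [sub_sub_cancel_left, abs_neg, abs_of_nonneg (hD0.1 ⟨α, rfl⟩)]⟩
  rw [← EReal.coe_le_coe_iff]
  refine h1.trans ?_
  calc liminf (fun α => (ρ (X - D α) : EReal)) atTop
      ≤ liminf (fun _ : I => (c : EReal)) atTop :=
        liminf_le_liminf (Eventually.of_forall fun α => EReal.coe_le_coe_iff.2 (h α))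
    _ = c := liminf_const _

/-- Translation reduces separation at an arbitrary point to separation at 0. -/
theorem FatouProperty.comp_add {ρ : Linfty 𝔓 → ℝ} (hρ : FatouProperty ρ) (X₀ : Linfty 𝔓) :
    FatouProperty fun X => ρ (X + X₀) := by
  intro I _ _ _ X Z ⟨D, hD, hD0, h⟩
  exact hρ I (fun α => X α + X₀) (Z + X₀) ⟨D, hD, hD0, fun α => by
    rw [add_sub_add_right_eq_sub]; exact h α⟩

theorem IsConvexRiskMeasure.comp_add {ρ : Linfty 𝔓 → ℝ} (hρ : IsConvexRiskMeasure ρ)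
    (X₀ : Linfty 𝔓) : IsConvexRiskMeasure fun X => ρ (X + X₀) where
  convex := by
    have := hρ.convex.translate_left X₀
    simpa [Function.comp_def] using this
  mono X Y h := hρ.mono _ _ (add_le_add_left h X₀)
  cash_additive X m := by rw [← hρ.cash_additive, add_right_comm]

theorem coeFn_abs_sub (X Z : Linfty 𝔓) :
    (|X - Z| : Linfty 𝔓) =ᵐ[qsMeasure 𝔓] fun ω => |X ω - Z ω| := by
  filter_upwards [Lp.coeFn_abs (X - Z), Lp.coeFn_sub X Z] with ω h1 h2
  rw [h1, h2, Pi.sub_apply]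

theorem abs_combo_sub_le (X Y Z : Linfty 𝔓) {a b : ℝ} (ha : 0 ≤ a) (hb : 0 ≤ b)
    (hab : a + b = 1) : |a • X + b • Y - Z| ≤ a • |X - Z| + b • |Y - Z| := by
  rw [← Lp.coeFn_le]
  filter_upwards [coeFn_abs_sub (a • X + b • Y) Z, coeFn_abs_sub X Z, coeFn_abs_sub Y Z,
    Lp.coeFn_add (a • X) (b • Y), Lp.coeFn_smul a X, Lp.coeFn_smul b Y,
    Lp.coeFn_add (a • |X - Z|) (b • |Y - Z|), Lp.coeFn_smul a |X - Z|,
    Lp.coeFn_smul b |Y - Z|] with ω h1 h2 h3 h4 h5 h6 h7 h8 h9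
  rw [h1, h4, Pi.add_apply, h5, h6, h7, Pi.add_apply, h8, h9, Pi.smul_apply, Pi.smul_apply,
    Pi.smul_apply, Pi.smul_apply, h2, h3]
  simp only [smul_eq_mul]
  have h : a * X ω + b * Y ω - Z ω = a * (X ω - Z ω) + b * (Y ω - Z ω) := by
    linear_combination (Z ω) * hab
  rw [h]
  refine (abs_add_le _ _).trans ?_
  rw [abs_mul, abs_mul, abs_of_nonneg ha, abs_of_nonneg hb]

/-- If `Z` lies in the closure of the convex set `A` for the topology induced by the order
continuous functionals, it lies in the closure of `A` for the seminorm `∫ |X| dμ`. -/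
theorem exists_integral_abs_sub_lt {μ : baC 𝔓} {m : Measure Ω} [IsFiniteMeasure m]
    (hm : ∀ A, MeasurableSet A → (μ : BA Ω) A = m.real A) (hμ : OrderContinuous (integral μ))
    {A : Set (Linfty 𝔓)} (hA : Convex ℝ A) {Z : Linfty 𝔓}
    (h : ∀ φ : Linfty 𝔓 →L[ℝ] ℝ, OrderContinuous φ → ∀ u, φ Z < u → ∃ X ∈ A, φ X < u)
    {ε : ℝ} (hε : 0 < ε) : ∃ X ∈ A, integral μ |X - Z| < ε := by
  have hmono : ∀ {X Y : Linfty 𝔓}, X ≤ Y → integral μ X ≤ integral μ Y := fun {X Y} hXY => by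
    have := integral_nonneg_of_eq_real hm (sub_nonneg.2 hXY)
    rw [map_sub] at this
    linarith
  by_contra! hcon
  set U : Set (Linfty 𝔓) := {X | integral μ |X - Z| < ε} with hU
  have hUopen : IsOpen U := by
    have hc : Continuous fun X : Linfty 𝔓 => |X - Z| :=
      (continuous_id.sub continuous_const).sup (continuous_id.sub continuous_const).neg
    exact isOpen_lt ((integral μ).continuous.comp hc) continuous_const
  have hUconv : Convex ℝ U := by
    intro X hX Y hY a b ha hb hab
    have h1 := hmono (abs_combo_sub_le X Y Z ha hb hab)
    rw [map_add, map_smul, map_smul, smul_eq_mul, smul_eq_mul] at h1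
    refine h1.trans_lt ?_
    change integral μ |X - Z| < ε at hX
    change integral μ |Y - Z| < ε at hY
    rcases ha.eq_or_lt with rfl | ha'
    · rw [zero_add] at hab
      subst hab
      linarith
    · nlinarith
  obtain ⟨ψ, u, hψU, hψA⟩ := geometric_hahn_banach_open hUconv hUopen hA
    (Set.disjoint_left.2 fun X hX hXA => absurd hX (not_lt.2 (hcon X hXA)))
  have hZU : Z ∈ U := by simpa [hU] using hε
  have hd : 0 < u - ψ Z := sub_pos.2 (hψU Z hZU)
  have hbound : ∀ H : Linfty 𝔓, 0 ≤ H → integral μ H < ε → |ψ H| < u - ψ Z := by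
    intro H hH hHε
    have h1 := hψU (Z + H) (by simpa [hU, abs_of_nonneg hH] using hHε)
    have h2 := hψU (Z - H) (by simpa [hU, abs_of_nonneg hH] using hHε)
    rw [map_add] at h1
    rw [map_sub] at h2
    rw [abs_lt]
    constructor <;> linarith
  -- By scaling, `hbound` controls `ψ` on positive elements by a multiple of `∫ · dμ`, so order
  -- continuity passes from `μ` to `ψ`. The hypothesis `h` then applies to `ψ` and contradicts the
  -- separation.
  have hψ : OrderContinuous ψ := by
    intro I _ _ _ D hD hD0
    rw [Metric.tendsto_nhds]
    intro η hη
    set t := (u - ψ Z) / η with ht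
    have htpos : 0 < t := div_pos hd hη
    filter_upwards [(hμ I D hD hD0).eventually_lt_const (div_pos hε htpos)] with α hα
    have h1 := hbound (t • D α) (smul_nonneg' htpos.le (hD0.1 ⟨α, rfl⟩)) (by
      rw [map_smul, smul_eq_mul]
      rwa [lt_div_iff₀ htpos, mul_comm] at hα)
    rw [map_smul, smul_eq_mul, abs_mul, abs_of_pos htpos, ht, div_mul_eq_mul_div,
      div_lt_iff₀ hη] at h1
    rw [Real.dist_eq, sub_zero]
    exact lt_of_mul_lt_mul_left h1 hd.le
  obtain ⟨X, hXA, hX⟩ := h ψ hψ u (hψU Z hZU)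
  exact absurd hX (not_lt.2 (hψA X hXA))

theorem IsConvexRiskMeasure.convex_sublevel {ρ : Linfty 𝔓 → ℝ} (hρ : IsConvexRiskMeasure ρ)
    (c r : ℝ) : Convex ℝ {X | ρ X ≤ c ∧ ‖X‖ ≤ r} := by
  have h1 := hρ.convex.convex_le c
  have h2 := convex_closedBall (0 : Linfty 𝔓) r
  convert h1.inter h2 using 1
  ext X
  simp

/-- Closedness of sublevel sets, localized to a set `S` on which `m` dominates `𝔓`. -/
theorem FatouProperty.le_of_mem_closure_of_restrict {ρ : Linfty 𝔓 → ℝ}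
    (hF : FatouProperty ρ) (hρ : IsConvexRiskMeasure ρ) {μ : baC 𝔓} {m : Measure Ω}
    [IsFiniteMeasure m] (hm : ∀ A, MeasurableSet A → (μ : BA Ω) A = m.real A)
    (hμ : OrderContinuous (integral μ)) {S : Set Ω} (hS : MeasurableSet S)
    (hres : (qsMeasure 𝔓).restrict S ≪ m) {c r : ℝ} {Z : Linfty 𝔓} (hZ : ‖Z‖ ≤ r)
    (h : ∀ φ : Linfty 𝔓 →L[ℝ] ℝ, OrderContinuous φ → ∀ u, φ Z < u →
      ∃ X ∈ {X | ρ X ≤ c ∧ ‖X‖ ≤ r}, φ X < u) :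
    ρ (Z - (2 * r) • ind 𝔓 Sᶜ hS.compl) ≤ c := by
  have hr : 0 ≤ r := (norm_nonneg Z).trans hZ
  have hac := absolutelyContinuous_of_eq_real hm
  -- With distance below `4⁻ⁿ`, Chebyshev at threshold `2⁻ⁿ` gives bad events of measure at most
  -- `2⁻ⁿ`, which is summable for Borel–Cantelli.
  choose X hXA hX using fun n : ℕ => exists_integral_abs_sub_lt hm hμ (hρ.convex_sublevel c r) h
    (ε := (1 / 2 : ℝ) ^ n * (1 / 2 : ℝ) ^ n) (by positivity)
  set b : ℕ → Set Ω := fun n => {ω | (1 / 2 : ℝ) ^ n ≤ |X n ω - Z ω|} with hb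
  have hbm : ∀ n, MeasurableSet (b n) := fun n => measurableSet_le measurable_const
    (((Lp.stronglyMeasurable (X n)).measurable.sub (Lp.stronglyMeasurable Z).measurable).abs)
  have hmb : ∀ n, m (b n) ≤ ENNReal.ofReal ((1 / 2 : ℝ) ^ n) := by
    intro n
    have h1 : integral μ |X n - Z| = ∫ ω, |X n ω - Z ω| ∂m := by
      rw [integral_eq_expectation hm]
      exact integral_congr_ae (hac.ae_le (coeFn_abs_sub _ _))
    have h2 := mul_meas_ge_le_integral_of_nonneg (μ := m) (f := fun ω => |X n ω - Z ω|)
      (Eventually.of_forall fun ω => abs_nonneg _)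
      ((integrable_of_absolutelyContinuous hac (X n)).sub
        (integrable_of_absolutelyContinuous hac Z)).abs ((1 / 2 : ℝ) ^ n)
    have h3 := h2.trans ((h1 ▸ hX n).le)
    have h4 : m.real (b n) ≤ (1 / 2 : ℝ) ^ n := le_of_mul_le_mul_left h3 (by positivity)
    rw [← ENNReal.ofReal_toReal (measure_ne_top m (b n))]
    exact ENNReal.ofReal_le_ofReal h4
  have hsum : ∑' n, m (b n) ≠ ∞ := by
    refine ne_top_of_le_ne_top ?_ (ENNReal.tsum_le_tsum hmb)
    rw [← ENNReal.ofReal_tsum_of_nonneg (fun n => by positivity) summable_geometric_two]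
    exact ENNReal.ofReal_ne_top
  -- Borel–Cantelli holds `m`-a.e.; domination on `S` makes it q.s. there.
  have hev := (ae_restrict_iff' hS).1 (hres.ae_le (ae_eventually_notMem hsum))
  set B : ℕ → Set Ω := fun n => (⋃ k, ⋃ (_ : n ≤ k), b k) ∩ S with hB
  have hBm : ∀ n, MeasurableSet (B n) := fun n =>
    (MeasurableSet.iUnion fun k => MeasurableSet.iUnion fun _ => hbm k).inter hS
  have hBanti : Antitone B := fun n n' hn => inter_subset_inter_left _ <|
    iUnion_mono fun k => iUnion_subset fun hk =>
      subset_iUnion (fun _ : n ≤ k => b k) (hn.trans hk)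
  -- The tail unions `B n` make this decreasing. The coefficient `2 * r` bounds `|X n - Z|` on bad
  -- points, since both norms are at most `r`.
  let D : ℕ → Linfty 𝔓 := fun n =>
    ((1 / 2 : ℝ) ^ n) • one 𝔓 + (2 * r) • ind 𝔓 (B n) (hBm n)
  have hDae : ∀ n, ∀ᵐ ω ∂(qsMeasure 𝔓),
      D n ω = (1 / 2 : ℝ) ^ n + 2 * r * (B n).indicator (fun _ => (1 : ℝ)) ω := fun n => by
    filter_upwards [Lp.coeFn_add (((1 / 2 : ℝ) ^ n) • one 𝔓) ((2 * r) • ind 𝔓 (B n) (hBm n)),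
      coeFn_smul_one 𝔓 ((1 / 2 : ℝ) ^ n), Lp.coeFn_smul (2 * r) (ind 𝔓 (B n) (hBm n)),
      coeFn_ind 𝔓 (hBm n)] with ω h1 h2 h3 h4
    rw [h1, Pi.add_apply, h2, h3, Pi.smul_apply, h4, smul_eq_mul]
  have hDanti : Antitone D := fun n n' hn => by
    rw [← Lp.coeFn_le]
    filter_upwards [hDae n, hDae n'] with ω h1 h2
    rw [h1, h2]
    have h3 : (1 / 2 : ℝ) ^ n' ≤ (1 / 2 : ℝ) ^ n :=
      pow_le_pow_of_le_one (by norm_num) (by norm_num) hn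
    have h4 := indicator_le_indicator_of_subset (f := fun _ => (1 : ℝ)) (hBanti hn)
      (fun _ => zero_le_one) ω
    have h5 := mul_le_mul_of_nonneg_left h4 (by positivity : 0 ≤ 2 * r)
    linarith
  have hD0 : IsGLB (range D) 0 := by
    refine ⟨?_, fun U hU => ?_⟩
    · rintro _ ⟨n, rfl⟩
      exact add_nonneg (smul_nonneg' (by positivity) (one_nonneg 𝔓))
        (smul_nonneg' (by positivity) (ind_nonneg _))
    · have hU' : ∀ᵐ ω ∂(qsMeasure 𝔓), ∀ n, U ω ≤ D n ω :=
        ae_all_iff.2 fun n => (Lp.coeFn_le _ _).2 (hU ⟨n, rfl⟩)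
      rw [← Lp.coeFn_le]
      filter_upwards [hU', ae_all_iff.2 hDae, hev, Lp.coeFn_zero ℝ ∞ (qsMeasure 𝔓)]
        with ω h1 h2 h3 h4
      rw [h4, Pi.zero_apply]
      have hlim : Tendsto (fun n : ℕ => (1 / 2 : ℝ) ^ n) atTop (𝓝 0) :=
        tendsto_pow_atTop_nhds_zero_of_lt_one (by norm_num) (by norm_num)
      have hex : ∀ᶠ n in atTop, ω ∉ B n := by
        by_cases hω : ω ∈ S
        · obtain ⟨n₀, hn₀⟩ := eventually_atTop.1 (h3 hω)
          refine eventually_atTop.2 ⟨n₀, fun n hn hωB => ?_⟩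
          obtain ⟨k, hk, hωk⟩ := mem_iUnion₂.1 hωB.1
          exact hn₀ k (hn.trans hk) hωk
        · exact Eventually.of_forall fun n hn => hω hn.2
      refine ge_of_tendsto hlim (hex.mono fun n hn => ?_)
      have := h1 n
      rwa [h2 n, indicator_of_notMem hn, mul_zero, add_zero] at this
  have hdir : IsDirectedOrder (ULift.{u} ℕ) := ⟨fun a b =>
    ⟨⟨max a.down b.down⟩, le_max_left a.down b.down, le_max_right a.down b.down⟩⟩
  refine hF.le_of_antitone (I := ULift.{u} ℕ) (D := fun n => D n.down)
    (fun n n' hn => hDanti hn) (by convert hD0 using 1; ext; simp) fun n => ?_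
  -- `Z - 2r·1_{Sᶜ} - D n ≤ X n` q.s.: off `b n` in `S` the `2⁻ⁿ` suffices, and elsewhere `2r` does.
  refine (hρ.mono _ _ ?_).trans (hXA n.down).1
  generalize n.down = n
  rw [← Lp.coeFn_le]
  filter_upwards [Lp.coeFn_sub (Z - (2 * r) • ind 𝔓 Sᶜ hS.compl) (D n),
    Lp.coeFn_sub Z ((2 * r) • ind 𝔓 Sᶜ hS.compl), Lp.coeFn_smul (2 * r) (ind 𝔓 Sᶜ hS.compl),
    coeFn_ind 𝔓 hS.compl, hDae n, ae_abs_le_norm Z, ae_abs_le_norm (X n)]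
    with ω h1 h2 h3 h4 h5 h6 h7
  rw [h1, Pi.sub_apply, h2, Pi.sub_apply, h3, Pi.smul_apply, h4, h5, smul_eq_mul]
  have h8 := (abs_le.1 (h6.trans hZ)).2
  have h9 := (abs_le.1 (h7.trans (hXA n).2)).1
  have h10 : (0 : ℝ) < (1 / 2) ^ n := by positivity
  have h11 : 0 ≤ (B n).indicator (fun _ => (1 : ℝ)) ω :=
    indicator_nonneg (fun _ _ => zero_le_one) ω
  by_cases hω : ω ∈ S
  · rw [indicator_of_notMem (fun h : ω ∈ Sᶜ => h hω)]
    by_cases hωb : ω ∈ b n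
    · have hωB : ω ∈ B n := ⟨mem_iUnion₂.2 ⟨n, le_rfl, hωb⟩, hω⟩
      rw [indicator_of_mem hωB]
      linarith
    · have h12 : |X n ω - Z ω| < (1 / 2 : ℝ) ^ n := not_le.1 fun h => hωb h
      have h14 := (abs_lt.1 h12).1
      have h13 := mul_nonneg (by positivity : 0 ≤ 2 * r) h11
      linarith
  · rw [indicator_of_mem (show ω ∈ Sᶜ from hω)]
    have h13 := mul_nonneg (by positivity : 0 ≤ 2 * r) h11
    linarith

/-- The `ν` with `∫ V dν = 0` form a subspace. Once it contains the supported probabilities it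
contains `sca_c`, which separates points by duality. -/
theorem scaC_separates (hY : DualIsLinfty (scaC 𝔓)) {V : Linfty 𝔓}
    (h : ∀ Q ∈ SupportedProb 𝔓, ∫ ω, V ω ∂(Q : Measure Ω) = 0) : V = 0 := by
  let Y : Submodule ℝ (baC 𝔓) :=
    { carrier := {ν | integral ν V = 0}
      zero_mem' := by simpa using integral_smul_left 0 (0 : baC 𝔓) V
      add_mem' := fun {μ ν} (hμ : integral μ V = 0) (hν : integral ν V = 0) => by
        change integral (μ + ν) V = 0
        rw [integral_add_left, hμ, hν, add_zero]
      smul_mem' := fun a ν (hν : integral ν V = 0) => by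
        change integral (a • ν) V = 0
        rw [integral_smul_left, hν, mul_zero] }
  have hle : scaC 𝔓 ≤ Y := scaC_le_of_supportedProb fun Q hQ ν hν => by
    change integral ν V = 0
    rw [integral_eq_expectation hν, h Q hQ]
  obtain ⟨E, _, _, e, j, hj, he⟩ := hY.exists_predual
  refine e.injective (ContinuousLinearMap.ext fun x => ?_)
  rw [he, map_zero]
  exact hle (hj ▸ mem_range_self x : j x ∈ (scaC 𝔓 : Set (baC 𝔓)))

/-- Bounded parts of sublevel sets of `ρ` are closed for the topology induced by the order
continuous functionals. -/
theorem FatouProperty.le_of_mem_closure (hY : DualIsLinfty (scaC 𝔓)) {ρ : Linfty 𝔓 → ℝ}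
    (hF : FatouProperty ρ) (hρ : IsConvexRiskMeasure ρ) {c r : ℝ} {Z : Linfty 𝔓} (hZ : ‖Z‖ ≤ r)
    (h : ∀ φ : Linfty 𝔓 →L[ℝ] ℝ, OrderContinuous φ → ∀ u, φ Z < u →
      ∃ X ∈ {X | ρ X ≤ c ∧ ‖X‖ ≤ r}, φ X < u) : ρ Z ≤ c := by
  have hr : 0 ≤ r := (norm_nonneg Z).trans hZ
  -- Events on which one finite measure from `sca_c` dominates `𝔓`; they are directed because such
  -- measures can be added. General finite measures are used so that sums need no normalization.
  let I := {S : Set Ω // MeasurableSet S ∧ ∃ μ ∈ scaC 𝔓, ∃ m : Measure Ω, IsFiniteMeasure m ∧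
    (∀ A, MeasurableSet A → (μ : BA Ω) A = m.real A) ∧ (qsMeasure 𝔓).restrict S ≪ m}
  have hdir : IsDirectedOrder I := ⟨by
    rintro ⟨S, hS, μ, hμ, m, hmf, hm, hres⟩ ⟨S', hS', μ', hμ', m', hmf', hm', hres'⟩
    refine ⟨⟨S ∪ S', hS.union hS', μ + μ', (scaC 𝔓).add_mem hμ hμ', m + m', inferInstance,
      fun A hA => ?_, ?_⟩, subset_union_left, subset_union_right⟩
    · rw [measureReal_add_apply, ← hm A hA, ← hm' A hA]; rfl
    · refine Measure.AbsolutelyContinuous.mk fun N hN hN0 => ?_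
      rw [Measure.add_apply, add_eq_zero] at hN0
      have h1 := hres hN0.1
      have h2 := hres' hN0.2
      rw [Measure.restrict_apply hN] at h1 h2 ⊢
      rw [inter_union_distrib_left]
      exact measure_union_null h1 h2⟩
  let i0 : I := ⟨∅, MeasurableSet.empty, 0, (scaC 𝔓).zero_mem, 0, inferInstance,
    fun A _ => by simp, by simp⟩
  have : Nonempty I := ⟨i0⟩
  refine hF.le_of_antitone (I := I) (D := fun S => (2 * r) • ind 𝔓 S.1ᶜ S.2.1.compl)
    (fun S S' hSS => ?_) ⟨?_, fun U hU => ?_⟩ ?_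
  · have h1 := smul_nonneg' (by positivity : 0 ≤ 2 * r)
      (sub_nonneg.2 (ind_mono (𝔓 := 𝔓) S'.2.1.compl S.2.1.compl (compl_subset_compl.2 hSS)))
    rwa [smul_sub, sub_nonneg] at h1
  · rintro _ ⟨S, rfl⟩
    exact smul_nonneg' (by positivity) (ind_nonneg _)
  -- The support of each supported `Q` is an index, so the positive part of a lower bound vanishes
  -- `Q`-a.s. for all such `Q`.
  · have hV : U ⊔ 0 = 0 := by
      refine scaC_separates hY fun Q hQ => ?_
      obtain ⟨S, hS, hQS, hres⟩ := exists_support hQ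
      obtain ⟨μ, hμ, hμQ⟩ := hQ
      let i : I := ⟨S, hS, μ, hμ, Q, inferInstance, hμQ, hres⟩
      have h1 : U ⊔ 0 ≤ (2 * r) • ind 𝔓 Sᶜ hS.compl :=
        sup_le (hU ⟨i, rfl⟩) (smul_nonneg' (by positivity) (ind_nonneg _))
      have h2 : (0 : Linfty 𝔓) ≤ U ⊔ 0 := le_sup_right
      have hac := absolutelyContinuous_of_eq_real hμQ
      rw [← Lp.coeFn_le] at h1
      rw [← Lp.coeFn_nonneg] at h2
      refine integral_eq_zero_of_ae ?_
      filter_upwards [hac.ae_le h1, hac.ae_le h2, measure_eq_zero_iff_ae_notMem.1 hQS,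
        hac.ae_le (coeFn_ind 𝔓 hS.compl), hac.ae_le (Lp.coeFn_smul (2 * r) (ind 𝔓 Sᶜ hS.compl))]
        with ω a b d f g
      rw [g, Pi.smul_apply, f, indicator_of_notMem d, smul_zero] at a
      exact le_antisymm a b
    exact hV ▸ le_sup_left
  · rintro ⟨S, hS, μ, hμ, m, hmf, hm, hres⟩
    exact hF.le_of_mem_closure_of_restrict hρ hm (hY.orderContinuous hμ) hS hres hZ h

/-! ### Separation and the dual representation -/

/-- Keeps the sublevel set at a level `c < ρ 0` at distance at least `ρ 0 - c` from the origin. -/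
theorem IsConvexRiskMeasure.apply_zero_le {ρ : Linfty 𝔓 → ℝ} (hρ : IsConvexRiskMeasure ρ)
    (X : Linfty 𝔓) : ρ 0 ≤ ρ X + ‖X‖ := by
  rw [← hρ.cash_additive]
  refine hρ.mono _ _ ?_
  have := le_norm_smul_one (-X)
  rw [norm_neg] at this
  exact neg_le_iff_add_nonneg'.1 this

/-- A risk measure with the Fatou property can be separated from each level below `ρ(0)` by an
order continuous functional. -/
theorem FatouProperty.exists_orderContinuous (hY : DualIsLinfty (scaC 𝔓)) {ρ : Linfty 𝔓 → ℝ}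
    (hF : FatouProperty ρ) (hρ : IsConvexRiskMeasure ρ) {c : ℝ} (hc : c < ρ 0) :
    ∃ ψ : Linfty 𝔓 →L[ℝ] ℝ, OrderContinuous ψ ∧ ∀ X, ρ X ≤ c → 1 ≤ ψ X := by
  obtain ⟨E, _, _, e, j, hj, he⟩ := hY.exists_predual
  set K : Set (StrongDual ℝ E) := {f | ρ (e.symm f) ≤ c} with hKdef
  have hK : Convex ℝ K := by
    intro f hf g hg a b ha hb hab
    have := hρ.convex.convex_le c ⟨mem_univ _, hf⟩ ⟨mem_univ _, hg⟩ ha hb hab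
    change ρ (e.symm (a • f + b • g)) ≤ c
    rw [map_add, map_smul, map_smul]
    exact this.2
  have hd : ∀ f ∈ K, (ρ 0 - c) / 2 < ‖f‖ := by
    intro f hf
    have h1 := hρ.apply_zero_le (e.symm f)
    rw [e.symm.norm_map] at h1
    have h2 : ρ (e.symm f) ≤ c := hf
    linarith
  have hclosed : ∀ r : ℝ, IsClosed {f : WeakDual ℝ E |
      WeakDual.toStrongDual f ∈ K ∧ ‖WeakDual.toStrongDual f‖ ≤ r} := by
    intro r
    refine isClosed_of_closure_subset fun f hf => ?_
    have hfr : ‖WeakDual.toStrongDual f‖ ≤ r := by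
      have h1 := closure_minimal (t := WeakDual.toStrongDual ⁻¹' Metric.closedBall 0 r)
        (fun g hg => by simpa using hg.2) (WeakDual.isClosed_closedBall (0 : StrongDual ℝ E) r) hf
      simpa using h1
    refine ⟨?_, hfr⟩
    refine hF.le_of_mem_closure hY hρ (r := r) (by rwa [e.symm.norm_map]) fun φ hφ u hu => ?_
    obtain ⟨μ, rfl⟩ := exists_integral_eq φ
    -- Every order continuous functional is evaluation at a point of the predual, so weak-star
    -- closure gives closure for all of them.
    obtain ⟨x, rfl⟩ : μ ∈ range j := hj ▸ hφ.mem_scaC hY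
    simp only [← he] at hu ⊢
    rw [e.apply_symm_apply] at hu
    obtain ⟨g, hgx, hg⟩ := mem_closure_iff.1 hf {g : WeakDual ℝ E | g x < u}
      (isOpen_lt (WeakDual.eval_continuous x) continuous_const) hu
    refine ⟨e.symm (WeakDual.toStrongDual g), ⟨hg.1, ?_⟩, ?_⟩
    · rw [e.symm.norm_map]; exact hg.2
    · rw [e.apply_symm_apply]; exact hgx
  obtain ⟨φ, hφK, hφ⟩ := exists_separating_of_isClosed_inter_closedBall hK hclosed
    (half_pos (sub_pos.2 hc)) hd
  refine ⟨φ.comp (e : Linfty 𝔓 →L[ℝ] StrongDual ℝ E), ?_, fun X hX => hφK _ ?_⟩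
  · intro I _ _ _ D hD hD0
    rw [Metric.tendsto_nhds]
    intro ε hε
    obtain ⟨α₀⟩ := ‹Nonempty I›
    -- The net stays in the ball of radius `‖D α₀‖` from `α₀` on, where `φ` is weak-star continuous;
    -- the bound is one-sided, hence its use at `± e (D α)`.
    obtain ⟨F, hFφ⟩ := hφ (ε / 2) (half_pos hε) ‖D α₀‖
    have hx : ∀ᶠ α in atTop, ∀ x ∈ F, |e (D α) x| ≤ ε / 2 := by
      refine (Filter.eventually_all_finset F).2 fun x _ => ?_
      have h1 := (orderContinuous_predual e x I D hD hD0).abs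
      rw [abs_zero] at h1
      exact h1.eventually_le_const (half_pos hε)
    filter_upwards [hx, eventually_ge_atTop α₀] with α hα hα₀
    have hn : ‖e (D α)‖ ≤ ‖D α₀‖ := by
      rw [e.norm_map]
      refine norm_le_of_abs_le ?_
      rw [abs_of_nonneg (hD0.1 ⟨α, rfl⟩)]
      exact hD hα₀
    have h1 := hFφ (e (D α)) hn hα
    have h2 := hFφ (-e (D α)) (by rwa [norm_neg]) fun x hxF => by
      rw [neg_apply, abs_neg]; exact hα x hxF
    rw [map_neg] at h2
    rw [Real.dist_eq, sub_zero]
    change |φ (e (D α))| < ε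
    rw [abs_lt]
    constructor <;> linarith
  · change ρ (e.symm (e X)) ≤ c
    rwa [e.symm_apply_apply]

/-- The negated separating functional is positive since the sublevel set is stable under decrease,
and has positive mass by cash-additivity. Normalizing it gives `Q`. -/
theorem FatouProperty.exists_supportedProb (hY : DualIsLinfty (scaC 𝔓)) {ρ : Linfty 𝔓 → ℝ}
    (hF : FatouProperty ρ) (hρ : IsConvexRiskMeasure ρ) {c : ℝ} (hc : c < ρ 0) :
    ∃ Q ∈ SupportedProb 𝔓, ∀ X : Linfty 𝔓, ∫ ω, X ω ∂(Q : Measure Ω) - ρ X ≤ -c := by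
  obtain ⟨ψ', hψ', hψK'⟩ := hF.exists_orderContinuous hY hρ hc
  obtain ⟨μ, hμψ⟩ := exists_integral_eq (-ψ')
  have hμo : OrderContinuous (integral μ) := by
    intro I _ _ _ D hD hD0
    have := (hψ' I D hD hD0).neg
    rw [neg_zero] at this
    exact this.congr fun α => by rw [hμψ]; rfl
  have hμ := hμo.mem_scaC hY
  have hK : ∀ X, ρ X ≤ c → integral μ X ≤ -1 := fun X hX => by
    have := hψK' X hX
    rw [hμψ, neg_apply]
    linarith
  have hcash : ∀ X, ρ (X + (c - ρ X) • one 𝔓) = c := fun X => by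
    rw [hρ.cash_additive]; ring
  have hpos : ∀ X : Linfty 𝔓, 0 ≤ X → 0 ≤ integral μ X := by
    intro X hX
    by_contra! hneg
    set X₁ : Linfty 𝔓 := 0 + (c - ρ 0) • one 𝔓
    -- Lowering `X₁` by `t • X` keeps it in the sublevel set but raises its integral to a
    -- nonnegative value, against the bound `-1`.
    set t := |integral μ X₁| / (-integral μ X) with ht
    have ht0 : 0 ≤ t := div_nonneg (abs_nonneg _) (by linarith)
    have h1 := hK (X₁ - t • X) ((hρ.mono _ _ (sub_le_self _ (smul_nonneg' ht0 hX))).trans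
      (hcash 0).le)
    rw [map_sub, map_smul, smul_eq_mul] at h1
    have h2 : t * integral μ X = -|integral μ X₁| := by
      rw [ht, div_mul_eq_mul_div, div_eq_iff (by linarith)]; ring
    have h3 := neg_abs_le (integral μ X₁)
    linarith
  set s := (μ : BA Ω) univ with hs
  have hs1 : (c - ρ 0) * s ≤ -1 := by
    have h1 := hK _ (hcash 0).le
    rwa [zero_add, map_smul, smul_eq_mul, integral_one] at h1
  have hs0 : 0 < s := by
    have h1 : 0 ≤ s := by
      rw [hs, ← integral_one]
      exact hpos _ (one_nonneg 𝔓)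
    rcases h1.eq_or_lt with h2 | h2
    · rw [← h2] at hs1
      linarith
    · exact h2
  have hμ' : ∀ A, ((s⁻¹ • μ : baC 𝔓) : BA Ω) A = s⁻¹ * (μ : BA Ω) A := fun A => rfl
  obtain ⟨Q, hQ, hQμ⟩ := QuasiSure.exists_supportedProb ((scaC 𝔓).smul_mem s⁻¹ hμ)
    (fun A hA => by
      rw [hμ', ← integral_ind μ A hA]
      exact mul_nonneg (inv_nonneg.2 hs0.le) (hpos _ (ind_nonneg hA)))
    (by rw [hμ']; exact inv_mul_cancel₀ hs0.ne')
  refine ⟨Q, hQ, fun X => ?_⟩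
  rw [← integral_eq_expectation hQμ, integral_smul_left]
  have h1 := hK _ (hcash X).le
  rw [map_add, map_smul, smul_eq_mul, integral_one] at h1
  have h2 : s⁻¹ * (integral μ X + (c - ρ X) * s) ≤ 0 :=
    mul_nonpos_of_nonneg_of_nonpos (inv_nonneg.2 hs0.le) (by linarith)
  have h3 : s⁻¹ * (integral μ X + (c - ρ X) * s) = s⁻¹ * integral μ X + (c - ρ X) := by
    field_simp
  linarith

/-- The penalty `β` is the convex conjugate of `ρ`. Separation at every level below `ρ X` excludes a
duality gap. -/
theorem FatouProperty.hasSupportedRepresentation (hY : DualIsLinfty (scaC 𝔓))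
    {ρ : Linfty 𝔓 → ℝ} (hF : FatouProperty ρ) (hρ : IsConvexRiskMeasure ρ) :
    HasSupportedRepresentation ρ := by
  let β : SupportedProb 𝔓 → EReal := fun Q =>
    ⨆ X : Linfty 𝔓, ((∫ ω, X ω ∂((Q : ProbabilityMeasure Ω) : Measure Ω) - ρ X : ℝ) : EReal)
  have hβle : ∀ (Q : SupportedProb 𝔓) (X : Linfty 𝔓),
      ((∫ ω, X ω ∂((Q : ProbabilityMeasure Ω) : Measure Ω) - ρ X : ℝ) : EReal) ≤ β Q :=
    fun Q X => le_iSup (fun X : Linfty 𝔓 =>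
      ((∫ ω, X ω ∂((Q : ProbabilityMeasure Ω) : Measure Ω) - ρ X : ℝ) : EReal)) X
  have key : ∀ (X : Linfty 𝔓) (c : ℝ), c < ρ X → ∃ Q : SupportedProb 𝔓,
      β Q ≤ ((∫ ω, X ω ∂((Q : ProbabilityMeasure Ω) : Measure Ω) - c : ℝ) : EReal) := by
    intro X c hc
    obtain ⟨Q, hQ, h⟩ := (hF.comp_add X).exists_supportedProb hY (hρ.comp_add X) (c := c)
      (by rwa [zero_add])
    refine ⟨⟨Q, hQ⟩, iSup_le fun X' => EReal.coe_le_coe_iff.2 ?_⟩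
    have h1 := h (X' - X)
    obtain ⟨ν, -, hν⟩ := hQ
    rw [sub_add_cancel, ← integral_eq_expectation hν, map_sub, integral_eq_expectation hν,
      integral_eq_expectation hν] at h1
    change ∫ ω, X' ω ∂(Q : Measure Ω) - ρ X' ≤ ∫ ω, X ω ∂(Q : Measure Ω) - c
    linarith
  refine ⟨β, ⟨-ρ 0, fun Q => ?_⟩, ?_, fun X => le_antisymm ?_ (iSup_le fun Q => ?_)⟩
  · refine le_trans (EReal.coe_le_coe_iff.2 ?_) (hβle Q 0)
    obtain ⟨ν, -, hν⟩ := Q.2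
    rw [← integral_eq_expectation hν, map_zero, zero_sub]
  · obtain ⟨Q, hQ⟩ := key 0 (ρ 0 - 1) (by linarith)
    exact ⟨Q, ne_top_of_le_ne_top (EReal.coe_ne_top _) hQ⟩
  · refine le_of_forall_lt fun c hc => ?_
    obtain ⟨d, hcd, hd⟩ := EReal.lt_iff_exists_real_btwn.1 hc
    obtain ⟨Q, hQ⟩ := key X d (EReal.coe_lt_coe_iff.1 hd)
    refine hcd.trans_le (le_trans ?_ (le_iSup _ Q))
    have := EReal.sub_le_sub (le_refl
      ((∫ ω, X ω ∂((Q : ProbabilityMeasure Ω) : Measure Ω) : ℝ) : EReal)) hQ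
    rwa [← EReal.coe_sub, sub_sub_cancel] at this
  · have h1 := hβle Q X
    generalize β Q = t at h1
    induction t with
    | bot => exact absurd (le_bot_iff.1 h1) (EReal.coe_ne_bot _)
    | top => simp
    | coe t =>
      rw [EReal.coe_le_coe_iff] at h1
      rw [← EReal.coe_sub, EReal.coe_le_coe_iff]
      linarith

end QuasiSure


theorem theorem5p10 {Ω : Type*} [MeasurableSpace Ω] (𝔓 : Set (ProbabilityMeasure Ω))
    (h𝔓 : 𝔓.Nonempty) (Y : Submodule ℝ (QuasiSure.baC 𝔓)) (hY : QuasiSure.DualIsLinfty Y) :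
    ((∀ ρ : QuasiSure.Linfty 𝔓 → ℝ, QuasiSure.IsConvexRiskMeasure ρ →
        (QuasiSure.FatouProperty ρ ↔ QuasiSure.HasDualRepresentation Y ρ)) →
      QuasiSure.DualIsLinfty (QuasiSure.scaC 𝔓)) ∧
    (QuasiSure.DualIsLinfty (QuasiSure.scaC 𝔓) →
      ∀ ρ : QuasiSure.Linfty 𝔓 → ℝ, QuasiSure.IsConvexRiskMeasure ρ →
        (QuasiSure.FatouProperty ρ ↔ QuasiSure.HasSupportedRepresentation ρ)) := by
  refine ⟨fun h => ?_, fun h ρ hρ =>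
    ⟨fun hF => hF.hasSupportedRepresentation h hρ, fun hR => hR.fatouProperty⟩⟩
  -- Duality for `Y` is carried to `sca_c` along `Y = sca_c`.
  exact hY.eq_scaC (fun ρ hρ => (h ρ hρ).1) ▸ hY
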